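/- **Notation.** Let $\hbar>0$. For $f\in L^1(\mathbb R^d)$ put $\widehat f(s)=(2\pi)^{-d}\int f(z)e^{-i\langle s,z\rangle}dz$. For $z=(x_1,\dots,x_p;\xi_1,\dots,\xi_p)\in\mathbb R^{6p}$ put $|z|=\sum_{j=1}^p(|x_j|+|\xi_j|)$. For $\sigma>0$ let $\mathcal A_{\sigma,p}$ be the set of $\tau\in L^1(\mathbb R^{6p})$ with $e^{\sigma|s|}\widehat\tau\in L^1(\mathbb R^{6p})$, and $\|\tau\|_\sigma=\int|\widehat\tau(s)|e^{\sigma|s|}ds$. The two-body potential is a function $w:\mathbb R^3\to\mathbb R$ in $L^1(\mathbb R^3)$ with $\|w\|_\sigma=\int_{\mathbb R^3}|\widehat w(k)|e^{\sigma|k|}dk<\infty$. The Weyl quantization of $\tau\in\mathcal A_{\sigma,p}$ is the bounded operator $a$ on $L^2(\mathbb R^{3p})$ with $$(a\psi)(x)=\frac1{(2\pi\hbar)^{3p}}\iint\tau\big(\tfrac{x+y}2,\xi\big)e^{i\langle x-y,\xi\rangle/\hbar}\psi(y)\,dy\,d\xi,\qquad\psi\in\mathcal S(\mathbb R^{3p});$$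 put $\|a\|_\sigma:=\|\tau\|_\sigma$. For a bounded operator $b$ on $L^2(\mathbb R^{3k})$ and $N\ge k$ let $A_N^{(k)}(b)$ be the operator $$A^{(k)}_N(b)=\frac{N(N-1)\cdots(N-k+1)}{N^k}\,P_S\,(b\otimes I^{(N-k)})\,P_S$$ on $\mathcal H^{(N)}=L^2_S(\mathbb R^{3N})$, the totally symmetric subspace of $L^2(\mathbb R^{3N})$, with $P_S$ the orthogonal projection onto it. Let $w^{ij}$ be multiplication by $w(x_i-x_j)$, let $w^{ij}_t=e^{i(\Delta_i+\Delta_j)t\hbar/2}\,w^{ij}\,e^{-i(\Delta_i+\Delta_j)t\hbar/2}$, and define the tree amplitudes of $a^{(p)}$, which are bounded operators on $L^2(\mathbb R^{3(p+n)})$, by $$g^{(0;p)}=a^{(p)},\qquad g^{(n;p)}_{t_1,\dots,t_n}=\frac i\hbar\sum_{i=1}^{p+n-1}\big[w^{i\,p+n}_{t_n},\,g^{(n-1;p)}_{t_1,\dots,t_{n-1}}\otimes I\big]\quad(n\ge1).$$ **Lemma.** For every $p$, every $\sigma>0$ and every $T\ge 0$ there is a constant $L>0$, depending only on $p$, $\sigma$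 and $T$ (in particular independent of $\hbar$), such that for all $\hbar>0$, all $w$ with $w\in L^1(\mathbb R^3)$ and $\|w\|_\sigma<\infty$, all $a^{(p)}$ that are the Weyl quantization of a symbol in $\mathcal A_{\sigma,p}$, all $n\ge0$, all $N\ge p+n$, and all real $t_1,\dots,t_n$ with $|t_j|\le T$, $$\big\|A_N^{(p+n)}\big(g^{(n;p)}_{t_1,\dots,t_n}\big)\big\|_{\mathcal H^{(N)}}\le L^n\,(n!)^3\,(2\|w\|_\sigma)^n\,\|a^{(p)}\|_\sigma .$$ -/

import Mathlib

open MeasureTheory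
open scoped ENNReal TensorProduct InnerProductSpace

noncomputable section

namespace MeanField

section Tensor

variable {X Y : Type*} [MeasurableSpace X] [MeasurableSpace Y] {μ : Measure X} {ν : Measure Y}

theorem memLp_tensor (φ : Lp ℂ 2 μ) (χ : Lp ℂ 2 ν) :
    MemLp (fun z : X × Y => φ z.1 * χ z.2) 2 (μ.prod ν) := by
  have h1 := Lp.memLp φ
  have h2 := Lp.memLp χ
  have hm : AEStronglyMeasurable (fun z : X × Y => φ z.1 * χ z.2) (μ.prod ν) :=
    h1.1.comp_fst.mul h2.1.comp_snd
  rw [memLp_two_iff_integrable_sq_norm hm]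
  simp_rw [norm_mul, mul_pow]
  exact ((memLp_two_iff_integrable_sq_norm h1.1).1 h1).mul_prod
    ((memLp_two_iff_integrable_sq_norm h2.1).1 h2)

/-- The product function `φ(x) χ(y)` as an element of `L²(X × Y)`. -/
def tensor (φ : Lp ℂ 2 μ) (χ : Lp ℂ 2 ν) : Lp ℂ 2 (μ.prod ν) :=
  (memLp_tensor φ χ).toLp _

theorem coeFn_tensor (φ : Lp ℂ 2 μ) (χ : Lp ℂ 2 ν) :
    tensor φ χ =ᵐ[μ.prod ν] fun z => φ z.1 * χ z.2 :=
  MemLp.coeFn_toLp _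

variable [SigmaFinite μ] [SigmaFinite ν]

theorem inner_tensor (φ φ' : Lp ℂ 2 μ) (χ χ' : Lp ℂ 2 ν) :
    ⟪tensor φ χ, tensor φ' χ'⟫_ℂ = ⟪φ, φ'⟫_ℂ * ⟪χ, χ'⟫_ℂ := by
  simp only [L2.inner_def]
  rw [← integral_prod_mul]
  apply integral_congr_ae
  filter_upwards [coeFn_tensor φ χ, coeFn_tensor φ' χ'] with z h1 h2
  rw [h1, h2]
  simp only [RCLike.inner_apply, map_mul]
  ring

variable (μ ν) in
/-- `φ ⊗ χ ↦ φ(x) χ(y)` as a linear map from the algebraic tensor product. -/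
def tensorLin : (Lp ℂ 2 μ ⊗[ℂ] Lp ℂ 2 ν) →ₗ[ℂ] Lp ℂ 2 (μ.prod ν) :=
  TensorProduct.lift <| LinearMap.mk₂ ℂ tensor
    (fun φ φ' χ => by
      apply Lp.ext
      filter_upwards [coeFn_tensor (φ + φ') χ, coeFn_tensor φ χ, coeFn_tensor φ' χ,
        Lp.coeFn_add (tensor φ χ) (tensor φ' χ),
        Measure.quasiMeasurePreserving_fst.ae (Lp.coeFn_add φ φ')] with z h1 h2 h3 h4 h5
      rw [h1, h4, h5]; simp only [Pi.add_apply]; rw [h2, h3]; ring)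
    (fun c φ χ => by
      apply Lp.ext
      filter_upwards [coeFn_tensor (c • φ) χ, coeFn_tensor φ χ,
        Lp.coeFn_smul c (tensor φ χ),
        Measure.quasiMeasurePreserving_fst.ae (Lp.coeFn_smul c φ)] with z h1 h2 h4 h5
      rw [h1, h4, h5]; simp only [Pi.smul_apply, smul_eq_mul]; rw [h2]; ring)
    (fun φ χ χ' => by
      apply Lp.ext
      filter_upwards [coeFn_tensor φ (χ + χ'), coeFn_tensor φ χ, coeFn_tensor φ χ',
        Lp.coeFn_add (tensor φ χ) (tensor φ χ'),
        Measure.quasiMeasurePreserving_snd.ae (Lp.coeFn_add χ χ')] with z h1 h2 h3 h4 h5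
      rw [h1, h4, h5]; simp only [Pi.add_apply]; rw [h2, h3]; ring)
    (fun c φ χ => by
      apply Lp.ext
      filter_upwards [coeFn_tensor φ (c • χ), coeFn_tensor φ χ,
        Lp.coeFn_smul c (tensor φ χ),
        Measure.quasiMeasurePreserving_snd.ae (Lp.coeFn_smul c χ)] with z h1 h2 h4 h5
      rw [h1, h4, h5]; simp only [Pi.smul_apply, smul_eq_mul]; rw [h2]; ring)

@[simp] theorem tensorLin_tmul (φ : Lp ℂ 2 μ) (χ : Lp ℂ 2 ν) :
    tensorLin μ ν (φ ⊗ₜ χ) = tensor φ χ := rfl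

theorem inner_tensorLin (u v : Lp ℂ 2 μ ⊗[ℂ] Lp ℂ 2 ν) :
    ⟪tensorLin μ ν u, tensorLin μ ν v⟫_ℂ = ⟪u, v⟫_ℂ := by
  induction u with
  | zero => simp
  | add a b ha hb => simp only [map_add, inner_add_left, ha, hb]
  | tmul φ χ =>
    induction v with
    | zero => simp
    | add a b ha hb => simp only [map_add, inner_add_right, ha, hb]
    | tmul φ' χ' => simp [inner_tensor]

theorem norm_tensorLin (u : Lp ℂ 2 μ ⊗[ℂ] Lp ℂ 2 ν) : ‖tensorLin μ ν u‖ = ‖u‖ := by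
  have h := inner_tensorLin u u
  have h1 := inner_self_eq_norm_sq_to_K (𝕜 := ℂ) (tensorLin μ ν u)
  have h2 := inner_self_eq_norm_sq_to_K (𝕜 := ℂ) u
  have h := h1.symm.trans (h.trans h2)
  have h' : ‖tensorLin μ ν u‖ ^ 2 = ‖u‖ ^ 2 := by exact_mod_cast h
  exact (sq_eq_sq₀ (norm_nonneg _) (norm_nonneg _)).1 h'

/-- Finite sums of product functions are dense in `L²(X × Y)`. -/
theorem denseRange_tensorLin : DenseRange (tensorLin μ ν) := by
  have key : (LinearMap.range (tensorLin μ ν))ᗮ = ⊥ := by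
    rw [Submodule.eq_bot_iff]
    intro f hf
    have hbox : ∀ (A : Set X) (B : Set Y), MeasurableSet A → MeasurableSet B → μ A ≠ ∞ →
        ν B ≠ ∞ → ∫ z in A ×ˢ B, f z ∂(μ.prod ν) = 0 := by
      intro A B hA hB hμA hνB
      have h0 : ⟪tensor (indicatorConstLp 2 hA hμA (1 : ℂ)) (indicatorConstLp 2 hB hνB (1 : ℂ)),
          f⟫_ℂ = 0 :=
        (Submodule.mem_orthogonal _ _).1 hf _
          ⟨indicatorConstLp 2 hA hμA (1 : ℂ) ⊗ₜ indicatorConstLp 2 hB hνB (1 : ℂ), rfl⟩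
      rw [L2.inner_def] at h0
      rw [← h0, ← integral_indicator (hA.prod hB)]
      apply integral_congr_ae
      filter_upwards [coeFn_tensor (indicatorConstLp 2 hA hμA (1 : ℂ))
        (indicatorConstLp 2 hB hνB (1 : ℂ)),
        Measure.quasiMeasurePreserving_fst.ae
          (indicatorConstLp_coeFn (p := 2) (hs := hA) (hμs := hμA) (c := (1 : ℂ))),
        Measure.quasiMeasurePreserving_snd.ae
          (indicatorConstLp_coeFn (p := 2) (hs := hB) (hμs := hνB) (c := (1 : ℂ)))]
        with z h1 h2 h3
      rw [h1, h2, h3]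
      by_cases ha : z.1 ∈ A <;> by_cases hb : z.2 ∈ B <;>
        simp [Set.indicator, Set.mem_prod, ha, hb]
    have hsub : ∀ i : ℕ, ∀ᵐ z ∂(μ.prod ν),
        z ∈ spanningSets μ i ×ˢ spanningSets ν i → f z = 0 := by
      intro i
      have hS : MeasurableSet (spanningSets μ i ×ˢ spanningSets ν i) :=
        (measurableSet_spanningSets μ i).prod (measurableSet_spanningSets ν i)
      have hfin : (μ.prod ν) (spanningSets μ i ×ˢ spanningSets ν i) < ∞ := by
        rw [Measure.prod_prod]
        exact ENNReal.mul_lt_top (measure_spanningSets_lt_top μ i)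
          (measure_spanningSets_lt_top ν i)
      have hint : IntegrableOn f (spanningSets μ i ×ˢ spanningSets ν i) (μ.prod ν) := by
        have : IsFiniteMeasure ((μ.prod ν).restrict
          (spanningSets μ i ×ˢ spanningSets ν i)) := ⟨by simpa using hfin⟩
        exact ((Lp.memLp f).restrict _).integrable (by norm_num)
      have hz := Integrable.ae_eq_zero_of_forall_setIntegral_eq_zero hint ?_
      · rw [Filter.EventuallyEq, ae_restrict_iff' hS] at hz
        exact hz
      intro s hs _
      refine MeasurableSpace.induction_on_inter
        (C := fun s _ => ∫ z in s, f z ∂((μ.prod ν).restrict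
          (spanningSets μ i ×ˢ spanningSets ν i)) = 0)
        generateFrom_prod.symm isPiSystem_prod ?_ ?_ ?_ ?_ s hs
      · simp
      · rintro _ ⟨A, hA, B, hB, rfl⟩
        rw [Measure.restrict_restrict (hA.prod hB), Set.prod_inter_prod]
        exact hbox _ _ (hA.inter (measurableSet_spanningSets μ i))
          (hB.inter (measurableSet_spanningSets ν i))
          (measure_ne_top_of_subset Set.inter_subset_right (measure_spanningSets_lt_top μ i).ne)
          (measure_ne_top_of_subset Set.inter_subset_right (measure_spanningSets_lt_top ν i).ne)
      · intro t ht h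
        have := integral_add_compl ht hint
        rw [h, zero_add, hbox _ _ (measurableSet_spanningSets μ i)
          (measurableSet_spanningSets ν i) (measure_spanningSets_lt_top μ i).ne
          (measure_spanningSets_lt_top ν i).ne] at this
        exact this
      · intro g hd hm h
        rw [integral_iUnion hm hd hint.integrableOn]
        simp [h]
    have hall : ∀ᵐ z ∂(μ.prod ν), f z = 0 := by
      filter_upwards [ae_all_iff.2 hsub] with z hz
      let i := max (spanningSetsIndex μ z.1) (spanningSetsIndex ν z.2)
      exact hz i ⟨monotone_spanningSets μ (le_max_left _ _) (mem_spanningSetsIndex μ z.1),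
        monotone_spanningSets ν (le_max_right _ _) (mem_spanningSetsIndex ν z.2)⟩
    apply Lp.ext
    filter_upwards [hall, Lp.coeFn_zero ℂ 2 (μ.prod ν)] with z h1 h2
    rw [h1, h2]; rfl
  have := Submodule.topologicalClosure_eq_top_iff.2 key
  rw [DenseRange, ← LinearMap.coe_range]
  exact Submodule.dense_iff_topologicalClosure_eq_top.2 this

end Tensor
/-- One-particle space `ℝ³`. -/
abbrev R3 : Type := EuclideanSpace ℝ (Fin 3)

/-- The configuration space `ℝ^{3m}` of `m` particles with its Euclidean structure and Lebesgue
measure; `x j : ℝ³` is the position of particle `j`. -/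
abbrev Config (m : ℕ) : Type := PiLp 2 (fun _ : Fin m => R3)

/-- `L²(ℝ^{3m})`. -/
abbrev L2 (m : ℕ) : Type := Lp ℂ 2 (volume : Measure (Config m))

/-! ### Bosons: permutations and the symmetric subspace -/

/-- `(U_π ψ)(x) = ψ(π x)`, where `π x` is `x` with its particle labels permuted. -/
def permOp {m : ℕ} (π : Equiv.Perm (Fin m)) : L2 m →ₗᵢ[ℂ] L2 m :=
  Lp.compMeasurePreservingₗᵢ ℂ (LinearIsometryEquiv.piLpCongrLeft 2 ℝ R3 π)
    (LinearIsometryEquiv.measurePreserving _)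

/-- `L²_S(ℝ^{3m})`: the totally symmetric part of `L²(ℝ^{3m})`. -/
def symL2 (m : ℕ) : Submodule ℂ (L2 m) where
  carrier := {ψ | ∀ π : Equiv.Perm (Fin m), permOp π ψ = ψ}
  add_mem' := fun ha hb π => by rw [map_add, ha π, hb π]
  zero_mem' := fun π => map_zero _
  smul_mem' := fun c ψ h π => by rw [map_smul, h π]

theorem isClosed_symL2 (m : ℕ) : IsClosed (symL2 m : Set (L2 m)) := by
  have : (symL2 m : Set (L2 m)) = ⋂ π : Equiv.Perm (Fin m), {ψ | permOp π ψ = ψ} := by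
    ext ψ; simp [symL2]
  rw [this]
  exact isClosed_iInter fun π => isClosed_eq (permOp π).continuous continuous_id

instance (m : ℕ) : CompleteSpace (symL2 m) := (isClosed_symL2 m).completeSpace_coe

/-! ### The operator `b ⊗ I` -/

/-- `x ↦ ((x_1,…,x_k), (x_{k+1},…,x_N))`. -/
def splitAt {k N : ℕ} (h : k ≤ N) (x : Config N) : Config k × Config (N - k) :=
  (WithLp.toLp 2 fun j => x (Fin.castLE h j),
   WithLp.toLp 2 fun j => x ⟨k + j, by omega⟩)

/-- The labels `1,…,k` and `k+1,…,N` together are the labels `1,…,N`. -/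
def labelEquiv {k N : ℕ} (h : k ≤ N) : Fin N ≃ Fin k ⊕ Fin (N - k) :=
  (finCongr (Nat.add_sub_of_le h).symm).trans finSumFinEquiv.symm

/-- `splitAt` as a linear isometry onto the Hilbert sum. -/
def splitIso {k N : ℕ} (h : k ≤ N) : Config N ≃ₗᵢ[ℝ] WithLp 2 (Config k × Config (N - k)) :=
  (LinearIsometryEquiv.piLpCongrLeft 2 ℝ R3 (labelEquiv h)).trans
    (PiLp.sumPiLpEquivProdLpPiLp 2 fun _ => R3)

theorem splitAt_eq {k N : ℕ} (h : k ≤ N) :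
    (splitAt h : Config N → _) = WithLp.ofLp ∘ splitIso h := by
  funext x
  apply Prod.ext
  · ext j : 1
    simp [splitAt, splitIso, labelEquiv]
    rfl
  · ext j : 1
    simp [splitAt, splitIso, labelEquiv]
    rfl

theorem measurePreserving_splitAt {k N : ℕ} (h : k ≤ N) :
    MeasurePreserving (splitAt h : Config N → _) volume
      ((volume : Measure (Config k)).prod (volume : Measure (Config (N - k)))) := by
  rw [splitAt_eq]
  exact (WithLp.volume_preserving_ofLp _ _).comp (splitIso h).measurePreserving

/-- `φ ⊗ χ ↦ φ(x_1,…,x_k) χ(x_{k+1},…,x_N)`, from the algebraic tensor product to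
`L²(ℝ^{3N})`. -/
def tensorMap {k N : ℕ} (h : k ≤ N) : (L2 k ⊗[ℂ] L2 (N - k)) →ₗ[ℂ] L2 N :=
  (Lp.compMeasurePreservingₗ ℂ (splitAt h) (measurePreserving_splitAt h)) ∘ₗ
    tensorLin volume volume

theorem coeFn_tensorMap {k N : ℕ} (h : k ≤ N) (φ : L2 k) (χ : L2 (N - k)) :
    tensorMap h (φ ⊗ₜ χ) =ᵐ[volume] fun x => φ (splitAt h x).1 * χ (splitAt h x).2 :=
  (Lp.coeFn_compMeasurePreserving _ (measurePreserving_splitAt h)).trans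
    ((measurePreserving_splitAt h).quasiMeasurePreserving.ae_eq_comp (coeFn_tensor φ χ))

theorem norm_tensorMap {k N : ℕ} (h : k ≤ N) (u : L2 k ⊗[ℂ] L2 (N - k)) :
    ‖tensorMap h u‖ = ‖u‖ :=
  (Lp.norm_compMeasurePreserving _ (measurePreserving_splitAt h)).trans (norm_tensorLin u)

theorem denseRange_tensorMap {k N : ℕ} (h : k ≤ N) : DenseRange (tensorMap h) := by
  have hsurj : Function.Surjective
      (Lp.compMeasurePreservingₗᵢ (E := ℂ) (p := 2) ℂ (splitAt h)
        (measurePreserving_splitAt h)) := by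
    intro ψ
    let e : Config N ≃ᵐ Config k × Config (N - k) :=
      (splitIso h).toMeasurableEquiv.trans (MeasurableEquiv.toLp 2 _).symm
    have he : (e : Config N → _) = splitAt h := by rw [splitAt_eq]; rfl
    have hmp : MeasurePreserving e volume
        ((volume : Measure (Config k)).prod (volume : Measure (Config (N - k)))) := by
      rw [he]; exact measurePreserving_splitAt h
    refine ⟨Lp.compMeasurePreserving e.symm hmp.symm ψ, ?_⟩
    apply Lp.ext
    refine (Lp.coeFn_compMeasurePreserving _ (measurePreserving_splitAt h)).trans ?_
    refine ((measurePreserving_splitAt h).quasiMeasurePreserving.ae_eq_comp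
      (Lp.coeFn_compMeasurePreserving ψ hmp.symm)).trans ?_
    refine Filter.Eventually.of_forall fun x => ?_
    simp [← he]
  exact hsurj.denseRange.comp denseRange_tensorLin
    (Lp.compMeasurePreservingₗᵢ (E := ℂ) (p := 2) ℂ (splitAt h) (measurePreserving_splitAt h)).continuous

/-- `b ⊗ I^{(N-k)}` on `L²(ℝ^{3N})`: the operator `b` acts on the first `k` particles. It is the
continuous extension of `φ ⊗ χ ↦ (b φ) ⊗ χ`. -/
def ampliation {k N : ℕ} (h : k ≤ N) (b : L2 k →L[ℂ] L2 k) : L2 N →L[ℂ] L2 N :=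
  (tensorMap h ∘ₗ (TensorProduct.map b.toLinearMap LinearMap.id)).extendOfNorm (tensorMap h)

theorem ampliation_tensorMap_bound {k N : ℕ} (h : k ≤ N) (b : L2 k →L[ℂ] L2 k)
    (u : L2 k ⊗[ℂ] L2 (N - k)) :
    ‖(tensorMap h ∘ₗ (TensorProduct.map b.toLinearMap LinearMap.id)) u‖
      ≤ ‖b‖ * ‖tensorMap h u‖ := by
  rw [LinearMap.comp_apply, norm_tensorMap, norm_tensorMap]
  have h1 : ‖b.rTensor (L2 (N - k)) u‖ ≤ ‖b.rTensor (L2 (N - k))‖ * ‖u‖ :=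
    (b.rTensor (L2 (N - k))).le_opNorm u
  exact h1.trans (mul_le_mul_of_nonneg_right (ContinuousLinearMap.norm_rTensor_le (L2 (N - k)) b) (norm_nonneg _))

/-- The defining property `(b ⊗ I)(φ ⊗ χ) = (b φ) ⊗ χ`. -/
theorem ampliation_tmul {k N : ℕ} (h : k ≤ N) (b : L2 k →L[ℂ] L2 k) (φ : L2 k)
    (χ : L2 (N - k)) :
    ampliation h b (tensorMap h (φ ⊗ₜ χ)) = tensorMap h (b φ ⊗ₜ χ) :=
  LinearMap.extendOfNorm_eq (denseRange_tensorMap h) ⟨‖b‖, ampliation_tensorMap_bound h b⟩ _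

/-- The `N`-particle operator `A_N(b) = N(N-1)⋯(N-k+1)/N^k · P_S (b ⊗ I^{(N-k)}) P_S` on
`L²_S(ℝ^{3N})`, where `P_S` is the orthogonal projection onto `L²_S(ℝ^{3N})`. -/
def manyBody {k N : ℕ} (h : k ≤ N) (b : L2 k →L[ℂ] L2 k) : symL2 N →L[ℂ] symL2 N :=
  ((N.descFactorial k : ℂ) / (N : ℂ) ^ k) •
    ((symL2 N).orthogonalProjectionOnto ∘L ampliation h b ∘L (symL2 N).subtypeL)

/-! ### Free evolution, interaction, tree amplitudes -/

open Classical in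
/-- Multiplication by an essentially bounded function `f` on `L²(ℝ^{3m})` (and `0` if `f` is not in
`L^∞`; this case does not occur below: `f` is either a phase, or `w(x_i - x_j)` with `i ≠ j` and
`w`, `ŵ` integrable, so that `w` agrees a.e. with a bounded continuous function). -/
def mulOp {m : ℕ} (f : Config m → ℂ) : L2 m →L[ℂ] L2 m :=
  if hf : MemLp f ∞ volume then
    (ContinuousLinearMap.mul ℂ ℂ).holderL volume ∞ 2 2 (hf.toLp f)
  else 0

theorem coeFn_mulOp {m : ℕ} {f : Config m → ℂ} (hf : MemLp f ∞ volume) (ψ : L2 m) :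
    mulOp f ψ =ᵐ[volume] fun x => f x * ψ x := by
  rw [mulOp, dif_pos hf]
  have h1 := ContinuousLinearMap.coeFn_holder (r := 2)
    (ContinuousLinearMap.mul ℂ ℂ : ℂ →L[ℂ] ℂ →L[ℂ] ℂ) (hf.toLp f) ψ
  refine h1.trans ?_
  filter_upwards [hf.coeFn_toLp] with x h2
  rw [h2]
  rfl

/-- The unitary operator `exp(i (Δ_i + Δ_j) t ħ / 2)` on `L²(ℝ^{3m})`, for `i ≠ j`. With the Fourier
transform `𝓕 ψ(κ) = ∫ ψ(x) exp(-2π i ⟨x, κ⟩) dx` on `L²`, the Laplacian `Δ_i` is multiplication by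
`-(2π)² |κ_i|²`. -/
def freeProp {m : ℕ} (ħ : ℝ) (i j : Fin m) (t : ℝ) : L2 m →L[ℂ] L2 m :=
  (Lp.fourierTransformₗᵢ (Config m) ℂ).symm.toContinuousLinearEquiv.toContinuousLinearMap ∘L
    mulOp (fun κ => Complex.exp
      (-(Complex.I * ((2 * Real.pi) ^ 2 * (‖κ i‖ ^ 2 + ‖κ j‖ ^ 2) * t * ħ / 2 : ℝ)))) ∘L
    (Lp.fourierTransformₗᵢ (Config m) ℂ).toContinuousLinearEquiv.toContinuousLinearMap

/-- `w^{ij}_t = exp(i(Δ_i+Δ_j)tħ/2) w(x_i - x_j) exp(-i(Δ_i+Δ_j)tħ/2)`. -/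
def pairPotential {m : ℕ} (ħ : ℝ) (w : R3 → ℝ) (i j : Fin m) (t : ℝ) : L2 m →L[ℂ] L2 m :=
  freeProp ħ i j t ∘L mulOp (fun x => (w (x i - x j) : ℂ)) ∘L freeProp ħ i j (-t)

/-- The tree amplitudes: `g^{(0)} = a` and
`g^{(n)}_{t_1,…,t_n} = (i/ħ) ∑_{i=1}^{p+n-1} [w^{i,p+n}_{t_n}, g^{(n-1)}_{t_1,…,t_{n-1}} ⊗ I]`. -/
def treeAmp (ħ : ℝ) (w : R3 → ℝ) {p : ℕ} (a : L2 p →L[ℂ] L2 p) (t : ℕ → ℝ) :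
    (n : ℕ) → (L2 (p + n) →L[ℂ] L2 (p + n))
  | 0 => a
  | n + 1 => (Complex.I / (ħ : ℂ)) • ∑ i : Fin (p + n),
      ⁅pairPotential ħ w i.castSucc (Fin.last (p + n)) (t (n + 1)),
        ampliation (Nat.le_succ (p + n)) (treeAmp ħ w a t n)⁆

/-! ### Symbols -/

/-- `ŵ(k) = (2π)^{-3} ∫ w(x) exp(-i⟨k, x⟩) dx` on `ℝ³`. -/
def potFourier (w : R3 → ℝ) (k : R3) : ℂ :=
  ((2 * Real.pi : ℂ) ^ 3)⁻¹ * ∫ x : R3, Complex.exp (-(Complex.I * ⟪k, x⟫_ℝ)) * (w x : ℂ)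

/-- `w ∈ L¹(ℝ³)` and `e^{σ|k|} ŵ ∈ L¹(ℝ³)`. -/
def MemPot (σ : ℝ) (w : R3 → ℝ) : Prop :=
  Integrable w ∧ Integrable fun k : R3 => (Real.exp (σ * ‖k‖) : ℂ) * potFourier w k

/-- `‖w‖_σ = ∫ |ŵ(k)| e^{σ|k|} dk`. -/
def potNorm (σ : ℝ) (w : R3 → ℝ) : ℝ :=
  ∫ k : R3, ‖potFourier w k‖ * Real.exp (σ * ‖k‖)

/-- `|z| = ∑_j (|x_j| + |ξ_j|)` on the phase space `ℝ^{3p} × ℝ^{3p}`. -/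
def phaseAbs {p : ℕ} (z : Config p × Config p) : ℝ :=
  ∑ j : Fin p, (‖z.1 j‖ + ‖z.2 j‖)

/-- `τ̂(s) = (2π)^{-6p} ∫ τ(z) exp(-i⟨s, z⟩) dz` on `ℝ^{6p}`, so that
`τ(z) = ∫ τ̂(s) exp(i⟨s, z⟩) ds`. -/
def symFourier {p : ℕ} (τ : Config p × Config p → ℂ) (s : Config p × Config p) : ℂ :=
  ((2 * Real.pi : ℂ) ^ (6 * p))⁻¹ * ∫ z : Config p × Config p,
    Complex.exp (-(Complex.I * (⟪s.1, z.1⟫_ℝ + ⟪s.2, z.2⟫_ℝ : ℝ))) * τ z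

/-- The class `𝒜_{σ,p}`: `τ ∈ L¹(ℝ^{6p})` and `e^{σ|s|} τ̂ ∈ L¹(ℝ^{6p})`. -/
def MemSym {p : ℕ} (σ : ℝ) (τ : Config p × Config p → ℂ) : Prop :=
  Integrable τ ∧
    Integrable fun s : Config p × Config p => (Real.exp (σ * phaseAbs s) : ℂ) * symFourier τ s

/-- `‖τ‖_σ = ∫ |τ̂(s)| e^{σ|s|} ds`. -/
def symNorm {p : ℕ} (σ : ℝ) (τ : Config p × Config p → ℂ) : ℝ :=
  ∫ s : Config p × Config p, ‖symFourier τ s‖ * Real.exp (σ * phaseAbs s)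

/-- `a` is the Weyl quantization of `τ`: the bounded operator on `L²(ℝ^{3p})` with
`(aψ)(x) = (2πħ)^{-3p} ∬ τ((x+y)/2, ξ) exp(i⟨x-y, ξ⟩/ħ) ψ(y) dy dξ` for all Schwartz `ψ`. -/
def IsWeylQuantization {p : ℕ} (ħ : ℝ) (τ : Config p × Config p → ℂ)
    (a : L2 p →L[ℂ] L2 p) : Prop :=
  ∀ ψ : SchwartzMap (Config p) ℂ,
    a (ψ.toLp 2) =ᵐ[volume] fun x : Config p =>
      ((2 * Real.pi * ħ : ℂ) ^ (3 * p))⁻¹ * ∫ q : Config p × Config p,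
        τ ((1 / 2 : ℝ) • (x + q.1), q.2) *
          Complex.exp (Complex.I * (⟪x - q.1, q.2⟫_ℝ / ħ : ℝ)) * ψ q.1

end MeanField

end

noncomputable section

namespace MeanField

/-! ### Weyl operators -/

section Weyl

variable {m : ℕ}

/-! All operators are written as superpositions of Weyl operators W(s), the quantizations of the
plane waves z ↦ exp(i⟨s, z⟩). These are contractions with W(s)W(s') = exp(iħω(s,s')/2) W(s+s'),
where ω is the symplectic form. Hence (i/ħ)[W(s), W(s')] is W(s+s') times a number of modulus
(2/ħ)|sin(ħω/2)| ≤ |ω| ≤ |s||s'|. This absorbs the 1/ħ in the recursion, uniformly in ħ.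

`IsWeylMixture ħ ρ B b` records a representation b = ∫ z W(s) dμ(s, z) whose mass weighted by
e^{ρ|s|} is at most B; then ‖b‖ ≤ B. Since x e^{ρx} ≤ e^{ρ'x}/(ρ'-ρ), a commutator multiplies the
masses at the cost of a smaller width ρ and one inverse gap for each factor
(`IsWeylMixture.commutator`).

Fourier inversion makes a quantized symbol a mixture of width σ and mass ‖τ‖_σ
(`isWeylMixture_of_isWeylQuantization`). The free evolution is quadratic in momentum, so it
conjugates exp(i⟨k, x_i - x_j⟩) into a single Weyl operator with |s| ≤ 2(1+T)|k|. Thus w_t^{ij} is a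
mixture of width ρ = σ/(2(1+T)) and mass ‖w‖_σ (`MemPot.isWeylMixture_pairPotential`).

The induction `isWeylMixture_treeAmp` uses the widths ρ_n = ρ/(2(n+1)). Passing from n to n+1 sums
p+n commutators and has a gap ρ_n - ρ_{n+1} of order ρ/n², which costs a factor of order n³/ρ²; the
product of these factors is the power of a constant times (n!)³. -/

theorem memLp_top_of_continuous_of_norm_le_one {g : Config m → ℂ} (hg : Continuous g)
    (h1 : ∀ x, ‖g x‖ ≤ 1) : MemLp g ∞ volume :=
  memLp_top_of_bound hg.aestronglyMeasurable 1 (Filter.Eventually.of_forall h1)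

theorem norm_mulOp_apply_le {g : Config m → ℂ} (hg : Continuous g)
    (h1 : ∀ x, ‖g x‖ ≤ 1) (ψ : L2 m) : ‖mulOp g ψ‖ ≤ ‖ψ‖ := by
  apply Lp.norm_le_norm_of_ae_le
  filter_upwards [coeFn_mulOp (memLp_top_of_continuous_of_norm_le_one hg h1) ψ] with x hx
  rw [hx, norm_mul]
  exact mul_le_of_le_one_left (norm_nonneg _) (h1 x)

/-- `(T_v ψ)(x) = ψ(x + v)`. -/
def translationOp (v : Config m) : L2 m →L[ℂ] L2 m :=
  (Lp.compMeasurePreservingₗᵢ ℂ (fun x : Config m => x + v)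
    (measurePreserving_add_right volume v)).toContinuousLinearMap

theorem coeFn_translationOp (v : Config m) (ψ : L2 m) :
    translationOp v ψ =ᵐ[volume] fun x => ψ (x + v) :=
  Lp.coeFn_compMeasurePreserving _ (measurePreserving_add_right volume v)

theorem norm_translationOp_apply (v : Config m) (ψ : L2 m) : ‖translationOp v ψ‖ = ‖ψ‖ :=
  Lp.norm_compMeasurePreserving _ (measurePreserving_add_right volume v)

/-- The multiplier `exp(i⟨s₁, x⟩ + iħ⟨s₁, s₂⟩/2)` of the Weyl operator. -/
def weylPhase (ħ : ℝ) (s : Config m × Config m) (x : Config m) : ℂ :=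
  Complex.exp (Complex.I * (⟪s.1, x⟫_ℝ + ħ / 2 * ⟪s.1, s.2⟫_ℝ : ℝ))

theorem norm_weylPhase (ħ : ℝ) (s : Config m × Config m) (x : Config m) :
    ‖weylPhase ħ s x‖ = 1 := by
  rw [weylPhase, mul_comm]
  exact Complex.norm_exp_ofReal_mul_I _

theorem continuous_weylPhase (ħ : ℝ) (s : Config m × Config m) :
    Continuous (weylPhase ħ s) := by
  unfold weylPhase
  fun_prop

theorem continuous_weylPhase_uncurry (ħ : ℝ) :
    Continuous fun q : (Config m × Config m) × Config m => weylPhase ħ q.1 q.2 := by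
  unfold weylPhase
  fun_prop

/-- The Weyl operator `W(s)`, the quantization of `z ↦ exp(i⟨s, z⟩)`:
`(W(s)ψ)(x) = exp(i⟨s₁, x⟩ + iħ⟨s₁, s₂⟩/2) ψ(x + ħ s₂)`. -/
def weylOp (ħ : ℝ) (s : Config m × Config m) : L2 m →L[ℂ] L2 m :=
  mulOp (weylPhase ħ s) ∘L translationOp (ħ • s.2)

theorem memLp_weylPhase (ħ : ℝ) (s : Config m × Config m) :
    MemLp (weylPhase ħ s) ∞ volume :=
  memLp_top_of_continuous_of_norm_le_one (continuous_weylPhase ħ s)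
    fun x => (norm_weylPhase ħ s x).le

theorem coeFn_weylOp (ħ : ℝ) (s : Config m × Config m) (ψ : L2 m) :
    weylOp ħ s ψ =ᵐ[volume] fun x => weylPhase ħ s x * ψ (x + ħ • s.2) := by
  refine (coeFn_mulOp (memLp_weylPhase ħ s) _).trans ?_
  filter_upwards [coeFn_translationOp (ħ • s.2) ψ] with x hx
  exact congrArg (weylPhase ħ s x * ·) hx

theorem norm_weylOp_apply_le (ħ : ℝ) (s : Config m × Config m) (ψ : L2 m) :
    ‖weylOp ħ s ψ‖ ≤ ‖ψ‖ :=
  (norm_mulOp_apply_le (continuous_weylPhase ħ s) (fun x => (norm_weylPhase ħ s x).le) _).trans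
    (norm_translationOp_apply _ _).le

theorem norm_inner_weylOp_le (ħ : ℝ) (s : Config m × Config m) (φ ψ : L2 m) :
    ‖⟪φ, weylOp ħ s ψ⟫_ℂ‖ ≤ ‖φ‖ * ‖ψ‖ :=
  (norm_inner_le_norm _ _).trans
    (mul_le_mul_of_nonneg_left (norm_weylOp_apply_le ħ s ψ) (norm_nonneg _))

theorem inner_weylOp (ħ : ℝ) (s : Config m × Config m) (φ ψ : L2 m) :
    ⟪φ, weylOp ħ s ψ⟫_ℂ =
      ∫ x, ⟪(φ x : ℂ), weylPhase ħ s x * ψ (x + ħ • s.2)⟫_ℂ := by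
  rw [L2.inner_def]
  apply integral_congr_ae
  filter_upwards [coeFn_weylOp ħ s ψ] with x hx
  rw [hx]

/-- L² classes come with strongly measurable representatives, so the integrand is jointly measurable
in (s, x). Plain measurability in s is wanted because the measures μ below may be singular with
respect to Lebesgue measure. -/
theorem measurable_inner_weylOp (ħ : ℝ) (φ ψ : L2 m) :
    Measurable fun s : Config m × Config m => ⟪φ, weylOp ħ s ψ⟫_ℂ := by
  simp_rw [inner_weylOp]
  apply StronglyMeasurable.measurable
  apply StronglyMeasurable.integral_prod_right
    (f := fun (s : Config m × Config m) (x : Config m) =>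
      ⟪(φ x : ℂ), weylPhase ħ s x * ψ (x + ħ • s.2)⟫_ℂ)
  have h1 : Measurable (φ : Config m → ℂ) := (Lp.stronglyMeasurable φ).measurable
  have h2 : Measurable (ψ : Config m → ℂ) := (Lp.stronglyMeasurable ψ).measurable
  have h3 := (continuous_weylPhase_uncurry (m := m) ħ).measurable
  have h4 : Measurable fun q : (Config m × Config m) × Config m => q.2 + ħ • q.1.2 := by
    fun_prop
  exact ((h1.comp measurable_snd).inner (h3.mul (h2.comp h4))).stronglyMeasurable

/-- The symplectic form `⟨s'₁, s₂⟩ - ⟨s₁, s'₂⟩`. -/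
def symplectic (s s' : Config m × Config m) : ℝ := ⟪s'.1, s.2⟫_ℝ - ⟪s.1, s'.2⟫_ℝ

theorem symplectic_swap (s s' : Config m × Config m) : symplectic s' s = -symplectic s s' := by
  unfold symplectic
  ring

/-- Moving the shift of W(s) past the phase of W(s') produces ħ⟨s'₁, s₂⟩; the half phases built into
`weylPhase` symmetrize this to ħω/2. -/
theorem weylOp_weylOp (ħ : ℝ) (s s' : Config m × Config m) (ψ : L2 m) :
    weylOp ħ s (weylOp ħ s' ψ) =
      Complex.exp (Complex.I * (ħ / 2 * symplectic s s' : ℝ)) • weylOp ħ (s + s') ψ := by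
  apply Lp.ext
  filter_upwards [coeFn_weylOp ħ s (weylOp ħ s' ψ), coeFn_weylOp ħ (s + s') ψ,
    (measurePreserving_add_right volume (ħ • s.2)).quasiMeasurePreserving.ae
      (coeFn_weylOp ħ s' ψ),
    Lp.coeFn_smul (Complex.exp (Complex.I * (ħ / 2 * symplectic s s' : ℝ)))
      (weylOp ħ (s + s') ψ)] with x h1 h2 h3 h4
  rw [h1, h4, h3, Pi.smul_apply, h2, smul_eq_mul, ← mul_assoc, ← mul_assoc]
  congr 1
  · simp only [weylPhase, ← Complex.exp_add, ← mul_add, ← Complex.ofReal_add, symplectic]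
    congr 3
    simp only [Prod.fst_add, Prod.snd_add, inner_add_left, inner_add_right, inner_smul_right]
    ring
  · rw [Prod.snd_add, smul_add, add_assoc]

theorem abs_inner_config_le (u v : Config m) :
    |⟪u, v⟫_ℝ| ≤ (∑ j, ‖u j‖) * ∑ j, ‖v j‖ := by
  rw [PiLp.inner_apply, Finset.sum_mul]
  refine (Finset.abs_sum_le_sum_abs _ _).trans (Finset.sum_le_sum fun j _ => ?_)
  refine (abs_real_inner_le_norm _ _).trans (mul_le_mul_of_nonneg_left ?_ (norm_nonneg _))
  exact Finset.single_le_sum (f := fun j => ‖v j‖) (fun i _ => norm_nonneg _)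
    (Finset.mem_univ j)

theorem phaseAbs_nonneg (s : Config m × Config m) : 0 ≤ phaseAbs s :=
  Finset.sum_nonneg fun _ _ => by positivity

theorem continuous_phaseAbs : Continuous (phaseAbs : Config m × Config m → ℝ) := by
  unfold phaseAbs
  fun_prop

theorem phaseAbs_add_le (s s' : Config m × Config m) :
    phaseAbs (s + s') ≤ phaseAbs s + phaseAbs s' := by
  unfold phaseAbs
  rw [← Finset.sum_add_distrib]
  refine Finset.sum_le_sum fun j _ => ?_
  have h1 := norm_add_le (s.1 j) (s'.1 j)
  have h2 := norm_add_le (s.2 j) (s'.2 j)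
  simp only [Prod.fst_add, Prod.snd_add, PiLp.add_apply]
  linarith

/-- The product on the right contains the two position-momentum cross terms that bound the form, and
the other two terms are nonnegative. -/
theorem abs_symplectic_le (s s' : Config m × Config m) :
    |symplectic s s'| ≤ phaseAbs s * phaseAbs s' := by
  unfold symplectic phaseAbs
  simp only [Finset.sum_add_distrib]
  have h1 := abs_inner_config_le s'.1 s.2
  have h2 := abs_inner_config_le s.1 s'.2
  have h3 := abs_sub (⟪s'.1, s.2⟫_ℝ) (⟪s.1, s'.2⟫_ℝ)
  have n1 : 0 ≤ ∑ j, ‖s.1 j‖ := Finset.sum_nonneg fun _ _ => norm_nonneg _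
  have n2 : 0 ≤ ∑ j, ‖s.2 j‖ := Finset.sum_nonneg fun _ _ => norm_nonneg _
  have n3 : 0 ≤ ∑ j, ‖s'.1 j‖ := Finset.sum_nonneg fun _ _ => norm_nonneg _
  have n4 : 0 ≤ ∑ j, ‖s'.2 j‖ := Finset.sum_nonneg fun _ _ => norm_nonneg _
  have n5 := mul_nonneg n1 n3
  have n6 := mul_nonneg n2 n4
  linarith

end Weyl

/-! ### Weyl operators and `b ⊗ I` -/

section Ampliation

variable {k N : ℕ}

/-- Extension of a `k`-particle configuration by zeros. -/
def extendZero (h : k ≤ N) (v : Config k) : Config N :=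
  (splitIso h).symm (WithLp.toLp 2 (v, 0))

theorem splitAt_extendZero (h : k ≤ N) (v : Config k) : splitAt h (extendZero h v) = (v, 0) := by
  rw [splitAt_eq, extendZero]
  simp

theorem splitAt_add_smul_extendZero (h : k ≤ N) (x : Config N) (c : ℝ) (v : Config k) :
    splitAt h (x + c • extendZero h v) = ((splitAt h x).1 + c • v, (splitAt h x).2) := by
  have := splitAt_extendZero h v
  rw [splitAt_eq] at this ⊢
  simp only [Function.comp_apply] at this ⊢
  rw [map_add, map_smul, WithLp.ofLp_add, WithLp.ofLp_smul, this]
  ext <;> simp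

theorem inner_extendZero (h : k ≤ N) (v : Config k) (x : Config N) :
    ⟪extendZero h v, x⟫_ℝ = ⟪v, (splitAt h x).1⟫_ℝ := by
  rw [splitAt_eq, extendZero, ← (splitIso h).inner_map_map, LinearIsometryEquiv.apply_symm_apply,
    WithLp.prod_inner_apply]
  simp

theorem continuous_extendZero (h : k ≤ N) : Continuous (extendZero h) := by
  unfold extendZero
  fun_prop

/-- Extension by zeros on phase space. -/
def extendPhase (h : k ≤ N) (s : Config k × Config k) : Config N × Config N :=
  (extendZero h s.1, extendZero h s.2)

theorem measurable_extendPhase (h : k ≤ N) : Measurable (extendPhase h) :=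
  (((continuous_extendZero h).comp continuous_fst).prodMk
    ((continuous_extendZero h).comp continuous_snd)).measurable

theorem sum_norm_extendZero (h : k ≤ N) (v : Config k) :
    ∑ j, ‖extendZero h v j‖ = ∑ j, ‖v j‖ := by
  have h1 := splitAt_extendZero h v
  rw [← Equiv.sum_comp (labelEquiv h).symm, Fintype.sum_sum_type]
  have h2 : ∀ j, extendZero h v ((labelEquiv h).symm (Sum.inl j)) = v j := fun j =>
    congrArg (fun q : Config k × Config (N - k) => q.1 j) h1
  have h3 : ∀ j, extendZero h v ((labelEquiv h).symm (Sum.inr j)) = 0 := fun j =>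
    congrArg (fun q : Config k × Config (N - k) => q.2 j) h1
  simp [h2, h3]

/-- Spectator particles leave the weight unchanged, so tensoring with the identity costs no width.
-/
theorem phaseAbs_extendPhase (h : k ≤ N) (s : Config k × Config k) :
    phaseAbs (extendPhase h s) = phaseAbs s := by
  simp only [phaseAbs, extendPhase, Finset.sum_add_distrib, sum_norm_extendZero]

theorem inner_tensorMap_tmul (h : k ≤ N) (φ φ' : L2 k) (χ χ' : L2 (N - k)) :
    ⟪tensorMap h (φ ⊗ₜ χ), tensorMap h (φ' ⊗ₜ χ')⟫_ℂ = ⟪φ, φ'⟫_ℂ * ⟪χ, χ'⟫_ℂ := by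
  rw [← inner_tensor]
  exact (Lp.compMeasurePreservingₗᵢ (E := ℂ) (p := 2) ℂ (splitAt h)
    (measurePreserving_splitAt h)).inner_map_map _ _

theorem ext_tensorMap (h : k ≤ N) {A B : L2 N →L[ℂ] L2 N}
    (H : ∀ φ χ, A (tensorMap h (φ ⊗ₜ χ)) = B (tensorMap h (φ ⊗ₜ χ))) : A = B := by
  have h1 : A.toLinearMap ∘ₗ tensorMap h = B.toLinearMap ∘ₗ tensorMap h :=
    TensorProduct.ext' H
  have h2 : (A : L2 N → L2 N) = B := (denseRange_tensorMap h).equalizer A.continuous B.continuous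
    (funext fun u => LinearMap.congr_fun h1 u)
  exact DFunLike.coe_injective h2

theorem ext_inner_tensorMap (h : k ≤ N) {u v : L2 N}
    (H : ∀ φ χ, ⟪tensorMap h (φ ⊗ₜ χ), u⟫_ℂ = ⟪tensorMap h (φ ⊗ₜ χ), v⟫_ℂ) : u = v := by
  have h1 : ∀ y, ⟪tensorMap h y, u⟫_ℂ = ⟪tensorMap h y, v⟫_ℂ := by
    intro y
    induction y with
    | zero => simp
    | add a b ha hb => simp only [map_add, inner_add_left, ha, hb]
    | tmul φ χ => exact H φ χ
  have h2 : (fun y : L2 N => ⟪y, u⟫_ℂ) = fun y => ⟪y, v⟫_ℂ :=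
    (denseRange_tensorMap h).equalizer (by fun_prop) (by fun_prop) (funext h1)
  exact ext_inner_left ℂ fun y => congrFun h2 y

/-- On a product function, the phase and the shift of the zero-extended frequency involve only the
first k particles. -/
theorem ampliation_weylOp (h : k ≤ N) (ħ : ℝ) (s : Config k × Config k) :
    ampliation h (weylOp ħ s) = weylOp ħ (extendPhase h s) := by
  apply ext_tensorMap h
  intro φ χ
  rw [ampliation_tmul]
  apply Lp.ext
  have hfst : Measure.QuasiMeasurePreserving (fun x : Config N => (splitAt h x).1) volume volume :=
    Measure.quasiMeasurePreserving_fst.comp (measurePreserving_splitAt h).quasiMeasurePreserving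
  filter_upwards [coeFn_tensorMap h (weylOp ħ s φ) χ,
    coeFn_weylOp ħ (extendPhase h s) (tensorMap h (φ ⊗ₜ χ)),
    (measurePreserving_add_right volume (ħ • (extendPhase h s).2)).quasiMeasurePreserving.ae
      (coeFn_tensorMap h φ χ), hfst.ae (coeFn_weylOp ħ s φ)] with x h1 h2 h3 h4
  rw [h1, h2, h3, h4]
  simp only [extendPhase]
  rw [splitAt_add_smul_extendZero]
  have : weylPhase ħ (extendZero h s.1, extendZero h s.2) x = weylPhase ħ s (splitAt h x).1 := by
    simp only [weylPhase, inner_extendZero, splitAt_extendZero]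
  rw [this, mul_assoc]

end Ampliation

/-! ### Integrals of Weyl operators -/

section Mixture

variable {m : ℕ}

theorem integrable_mul_inner_weylOp {ħ : ℝ} {μ : Measure ((Config m × Config m) × ℂ)}
    (hμ : Integrable (fun q => q.2) μ) (φ ψ : L2 m) :
    Integrable (fun q => q.2 * ⟪φ, weylOp ħ q.1 ψ⟫_ℂ) μ :=
  hμ.mul_bdd (c := ‖φ‖ * ‖ψ‖)
    ((measurable_inner_weylOp ħ φ ψ).comp measurable_fst).aestronglyMeasurable
    (Filter.Eventually.of_forall fun q => norm_inner_weylOp_le ħ q.1 φ ψ)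

theorem norm_integral_mul_inner_weylOp_le {ħ : ℝ} {μ : Measure ((Config m × Config m) × ℂ)}
    (hμ : Integrable (fun q => q.2) μ) (φ ψ : L2 m) :
    ‖∫ q, q.2 * ⟪φ, weylOp ħ q.1 ψ⟫_ℂ ∂μ‖ ≤ (∫ q, ‖q.2‖ ∂μ) * ‖φ‖ * ‖ψ‖ := by
  rw [mul_assoc, ← integral_mul_const]
  refine norm_integral_le_of_norm_le (hμ.norm.mul_const _) (Filter.Eventually.of_forall fun q => ?_)
  rw [norm_mul]
  exact mul_le_mul_of_nonneg_left (norm_inner_weylOp_le ħ q.1 φ ψ) (norm_nonneg _)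

/-- The weak integral `∫ z W(s) dμ(s, z)` is a bounded operator. -/
theorem exists_integral_weylOp (ħ : ℝ) {μ : Measure ((Config m × Config m) × ℂ)}
    (hμ : Integrable (fun q => q.2) μ) :
    ∃ b : L2 m →L[ℂ] L2 m, ∀ φ ψ, ⟪φ, b ψ⟫_ℂ = ∫ q, q.2 * ⟪φ, weylOp ħ q.1 ψ⟫_ℂ ∂μ := by
  have hI := integrable_mul_inner_weylOp (ħ := ħ) hμ
  let S : L2 m →ₗ⋆[ℂ] L2 m →ₗ[ℂ] ℂ := LinearMap.mk₂'ₛₗ (starRingEnd ℂ) (RingHom.id ℂ)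
    (fun φ ψ => ∫ q, q.2 * ⟪φ, weylOp ħ q.1 ψ⟫_ℂ ∂μ)
    (fun φ φ' ψ => by
      rw [← integral_add (hI _ _) (hI _ _)]
      simp only [inner_add_left, mul_add])
    (fun c φ ψ => by
      rw [smul_eq_mul, ← integral_const_mul]
      simp only [inner_smul_left, mul_left_comm])
    (fun φ ψ ψ' => by
      rw [← integral_add (hI _ _) (hI _ _)]
      simp only [map_add, inner_add_right, mul_add])
    (fun c φ ψ => by
      rw [smul_eq_mul, ← integral_const_mul]
      simp only [map_smul, inner_smul_right, mul_left_comm, RingHom.id_apply])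
  let S' : L2 m →L⋆[ℂ] L2 m →L[ℂ] ℂ := S.mkContinuous₂ (∫ q, ‖q.2‖ ∂μ)
    fun φ ψ => norm_integral_mul_inner_weylOp_le hμ φ ψ
  -- The representing operator of the form acts on the left argument of the inner product, whence
  -- the adjoint.
  refine ⟨ContinuousLinearMap.adjoint (InnerProductSpace.continuousLinearMapOfBilin S'),
    fun φ ψ => ?_⟩
  rw [ContinuousLinearMap.adjoint_inner_right,
    InnerProductSpace.continuousLinearMapOfBilin_apply]
  rfl

/-- `b = ∫ z W(s) dμ(s, z)` for a measure `μ` with `∫ |z| e^{ρ|s|} dμ ≤ B`. -/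
def IsWeylMixture (ħ ρ B : ℝ) (b : L2 m →L[ℂ] L2 m) : Prop :=
  ∃ μ : Measure ((Config m × Config m) × ℂ), SFinite μ ∧
    Integrable (fun q => Real.exp (ρ * phaseAbs q.1) * ‖q.2‖) μ ∧
    ∫ q, Real.exp (ρ * phaseAbs q.1) * ‖q.2‖ ∂μ ≤ B ∧
    ∀ φ ψ, ⟪φ, b ψ⟫_ℂ = ∫ q, q.2 * ⟪φ, weylOp ħ q.1 ψ⟫_ℂ ∂μ

theorem integrable_snd_of_integrable_exp_mul {ρ : ℝ} (hρ : 0 ≤ ρ)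
    {μ : Measure ((Config m × Config m) × ℂ)}
    (h : Integrable (fun q => Real.exp (ρ * phaseAbs q.1) * ‖q.2‖) μ) :
    Integrable (fun q => q.2) μ := by
  refine h.mono' measurable_snd.aestronglyMeasurable (Filter.Eventually.of_forall fun q => ?_)
  exact le_mul_of_one_le_left (norm_nonneg _)
    (Real.one_le_exp (mul_nonneg hρ (phaseAbs_nonneg _)))

variable {ħ ρ B : ℝ} {b : L2 m →L[ℂ] L2 m}

theorem IsWeylMixture.mono (h : IsWeylMixture ħ ρ B b) {ρ' B' : ℝ} (hρ : ρ' ≤ ρ) (hB : B ≤ B') :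
    IsWeylMixture ħ ρ' B' b := by
  obtain ⟨μ, hs, hi, hle, hb⟩ := h
  have key : ∀ q : (Config m × Config m) × ℂ, Real.exp (ρ' * phaseAbs q.1) * ‖q.2‖ ≤
      Real.exp (ρ * phaseAbs q.1) * ‖q.2‖ := fun q => by
    have := phaseAbs_nonneg q.1
    gcongr
  have hi' : Integrable (fun q => Real.exp (ρ' * phaseAbs q.1) * ‖q.2‖) μ := by
    refine hi.mono' (Continuous.aestronglyMeasurable ?_) (Filter.Eventually.of_forall fun q => ?_)
    · have := continuous_phaseAbs (m := m)
      fun_prop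
    · rw [Real.norm_of_nonneg (by positivity)]
      exact key q
  exact ⟨μ, hs, hi', (integral_mono hi' hi key).trans (hle.trans hB), hb⟩

/-- Each Weyl operator is a contraction, so the matrix elements are bounded by ∫ |z| dμ; testing
against φ = bψ gives the operator norm. -/
theorem IsWeylMixture.norm_le (h : IsWeylMixture ħ ρ B b) (hρ : 0 ≤ ρ) : ‖b‖ ≤ B := by
  obtain ⟨μ, -, hi, hle, hb⟩ := h.mono hρ le_rfl
  have hint := integrable_snd_of_integrable_exp_mul le_rfl hi
  simp only [zero_mul, Real.exp_zero, one_mul] at hle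
  have hB : 0 ≤ B := (integral_nonneg fun _ => norm_nonneg _).trans hle
  refine ContinuousLinearMap.opNorm_le_bound _ hB fun ψ => ?_
  have h1 : ‖⟪b ψ, b ψ⟫_ℂ‖ ≤ B * ‖b ψ‖ * ‖ψ‖ := by
    rw [hb]
    refine (norm_integral_mul_inner_weylOp_le hint _ _).trans ?_
    gcongr
  rw [inner_self_eq_norm_sq_to_K] at h1
  have h2 : ‖b ψ‖ * ‖b ψ‖ ≤ ‖b ψ‖ * (B * ‖ψ‖) := by
    calc ‖b ψ‖ * ‖b ψ‖ = ‖((‖b ψ‖ : ℂ)) ^ 2‖ := by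
          rw [norm_pow, Complex.norm_real, norm_norm, sq]
      _ ≤ B * ‖b ψ‖ * ‖ψ‖ := h1
      _ = ‖b ψ‖ * (B * ‖ψ‖) := by ring
  by_cases h0 : ‖b ψ‖ = 0
  · rw [h0]; positivity
  · exact le_of_mul_le_mul_left h2 (lt_of_le_of_ne (norm_nonneg _) (Ne.symm h0))

theorem IsWeylMixture.zero : IsWeylMixture ħ ρ 0 (0 : L2 m →L[ℂ] L2 m) :=
  ⟨0, inferInstance, by simp, by simp, by simp⟩

theorem IsWeylMixture.add (hρ : 0 ≤ ρ) {B' : ℝ} {b' : L2 m →L[ℂ] L2 m}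
    (h : IsWeylMixture ħ ρ B b) (h' : IsWeylMixture ħ ρ B' b') :
    IsWeylMixture ħ ρ (B + B') (b + b') := by
  obtain ⟨μ, hs, hi, hle, hb⟩ := h
  obtain ⟨μ', hs', hi', hle', hb'⟩ := h'
  refine ⟨μ + μ', inferInstance, hi.add_measure hi', ?_, fun φ ψ => ?_⟩
  · rw [integral_add_measure hi hi']
    exact add_le_add hle hle'
  · rw [integral_add_measure
      (integrable_mul_inner_weylOp (integrable_snd_of_integrable_exp_mul hρ hi) φ ψ)
      (integrable_mul_inner_weylOp (integrable_snd_of_integrable_exp_mul hρ hi') φ ψ),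
      ← hb, ← hb', add_apply, inner_add_right]

theorem IsWeylMixture.sum (hρ : 0 ≤ ρ) {ι : Type*} (t : Finset ι)
    {β : ι → L2 m →L[ℂ] L2 m} (h : ∀ i, IsWeylMixture ħ ρ B (β i)) :
    IsWeylMixture ħ ρ (t.card * B) (∑ i ∈ t, β i) := by
  classical
  induction t using Finset.induction_on with
  | empty => simpa using IsWeylMixture.zero
  | insert i t hi ih =>
    rw [Finset.sum_insert hi, Finset.card_insert_of_notMem hi]
    refine ((h i).add hρ ih).mono le_rfl (le_of_eq ?_)
    push_cast
    ring

theorem IsWeylMixture.ampliation (hρ : 0 ≤ ρ) {N : ℕ} (hN : m ≤ N)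
    (h : IsWeylMixture ħ ρ B b) : IsWeylMixture ħ ρ B (ampliation hN b) := by
  obtain ⟨μ, hs, hi, hle, hb⟩ := h
  have hf : Measurable fun q : (Config m × Config m) × ℂ => (extendPhase hN q.1, q.2) :=
    ((measurable_extendPhase hN).comp measurable_fst).prodMk measurable_snd
  have hg : Continuous fun q : (Config N × Config N) × ℂ =>
      Real.exp (ρ * phaseAbs q.1) * ‖q.2‖ := by
    have := continuous_phaseAbs (m := N)
    fun_prop
  have hi' : Integrable (fun q => Real.exp (ρ * phaseAbs q.1) * ‖q.2‖)
      (μ.map fun q => (extendPhase hN q.1, q.2)) := by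
    rw [integrable_map_measure hg.aestronglyMeasurable hf.aemeasurable]
    simpa only [Function.comp_def, phaseAbs_extendPhase] using hi
  have hz := integrable_snd_of_integrable_exp_mul hρ hi'
  refine ⟨_, inferInstance, hi', ?_, ?_⟩
  · rw [integral_map hf.aemeasurable hg.aestronglyMeasurable]
    simpa only [phaseAbs_extendPhase] using hle
  obtain ⟨b', hb'⟩ := exists_integral_weylOp ħ hz
  -- The pushforward measure already defines an operator `b'`; it only has to be identified with b ⊗
  -- I on product vectors, where both matrix elements factorize.
  suffices MeanField.ampliation hN b = b' by rw [this]; exact hb'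
  refine ext_tensorMap hN fun φ χ => ext_inner_tensorMap hN fun φ' χ' => ?_
  rw [hb', integral_map hf.aemeasurable
    (integrable_mul_inner_weylOp hz _ _).aestronglyMeasurable, ampliation_tmul,
    inner_tensorMap_tmul, hb, ← integral_mul_const]
  refine integral_congr_ae (Filter.Eventually.of_forall fun q => ?_)
  simp only
  rw [← ampliation_weylOp, ampliation_tmul, inner_tensorMap_tmul, mul_assoc]

/-- Matrix elements of the product of two integrals of Weyl operators. -/
theorem inner_comp_eq_integral {μ₁ μ₂ : Measure ((Config m × Config m) × ℂ)} [SFinite μ₁]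
    [SFinite μ₂] (h₁ : Integrable (fun q => q.2) μ₁) (h₂ : Integrable (fun q => q.2) μ₂)
    {b₁ b₂ : L2 m →L[ℂ] L2 m}
    (hb₁ : ∀ φ ψ, ⟪φ, b₁ ψ⟫_ℂ = ∫ q, q.2 * ⟪φ, weylOp ħ q.1 ψ⟫_ℂ ∂μ₁)
    (hb₂ : ∀ φ ψ, ⟪φ, b₂ ψ⟫_ℂ = ∫ q, q.2 * ⟪φ, weylOp ħ q.1 ψ⟫_ℂ ∂μ₂) (φ ψ : L2 m) :
    Integrable (fun q : ((Config m × Config m) × ℂ) × ((Config m × Config m) × ℂ) =>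
      q.1.2 * q.2.2 * (Complex.exp (Complex.I * (ħ / 2 * symplectic q.1.1 q.2.1 : ℝ)) *
        ⟪φ, weylOp ħ (q.1.1 + q.2.1) ψ⟫_ℂ)) (μ₁.prod μ₂) ∧
    ⟪φ, b₁ (b₂ ψ)⟫_ℂ = ∫ q, q.1.2 * q.2.2 *
      (Complex.exp (Complex.I * (ħ / 2 * symplectic q.1.1 q.2.1 : ℝ)) *
        ⟪φ, weylOp ħ (q.1.1 + q.2.1) ψ⟫_ℂ) ∂(μ₁.prod μ₂) := by
  have hI : Integrable (fun q : ((Config m × Config m) × ℂ) × ((Config m × Config m) × ℂ) =>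
      q.1.2 * q.2.2 * (Complex.exp (Complex.I * (ħ / 2 * symplectic q.1.1 q.2.1 : ℝ)) *
        ⟪φ, weylOp ħ (q.1.1 + q.2.1) ψ⟫_ℂ)) (μ₁.prod μ₂) := by
    refine (h₁.mul_prod h₂).mul_bdd (c := ‖φ‖ * ‖ψ‖) ?_ (Filter.Eventually.of_forall fun q => ?_)
    · refine Measurable.aestronglyMeasurable (Measurable.mul ?_ ?_)
      · refine Continuous.measurable ?_
        unfold symplectic
        fun_prop
      · exact (measurable_inner_weylOp ħ φ ψ).comp (by fun_prop)
    · rw [norm_mul, mul_comm Complex.I, Complex.norm_exp_ofReal_mul_I, one_mul]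
      exact norm_inner_weylOp_le _ _ _ _
  refine ⟨hI, ?_⟩
  rw [integral_prod _ hI, hb₁]
  refine integral_congr_ae (Filter.Eventually.of_forall fun q => ?_)
  simp only
  -- Moving W(s) onto the left vector lets the weak representation of `b₂` be applied with W(s)*φ in
  -- place of φ.
  rw [← ContinuousLinearMap.adjoint_inner_left, hb₂, ← integral_const_mul]
  refine integral_congr_ae (Filter.Eventually.of_forall fun q' => ?_)
  simp only
  rw [ContinuousLinearMap.adjoint_inner_left, weylOp_weylOp, inner_smul_right, mul_assoc]

/-- A Cauchy-type estimate: one power of |s| is paid for by shrinking the width. The resulting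
inverse gaps are responsible for two of the three factors n!. -/
theorem mul_exp_le_exp_div {ρ ρ' x : ℝ} (h : ρ' < ρ) :
    x * Real.exp (ρ' * x) ≤ Real.exp (ρ * x) / (ρ - ρ') := by
  rw [le_div_iff₀ (sub_pos.2 h)]
  have h1 : (ρ - ρ') * x ≤ Real.exp ((ρ - ρ') * x) := by
    linarith [Real.add_one_le_exp ((ρ - ρ') * x)]
  calc x * Real.exp (ρ' * x) * (ρ - ρ') = (ρ - ρ') * x * Real.exp (ρ' * x) := by ring
    _ ≤ Real.exp ((ρ - ρ') * x) * Real.exp (ρ' * x) := by gcongr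
    _ = Real.exp (ρ * x) := by rw [← Real.exp_add]; congr 1; ring

/-- The coefficient of `W(s + s')` in `(i/ħ)[W(s), W(s')]`. -/
def commutatorCoeff (ħ : ℝ) (s s' : Config m × Config m) : ℂ :=
  Complex.I / ħ * (Complex.exp (Complex.I * (ħ / 2 * symplectic s s' : ℝ)) -
    Complex.exp (Complex.I * (ħ / 2 * symplectic s' s : ℝ)))

theorem measurable_commutatorCoeff (ħ : ℝ) {α : Type*} [MeasurableSpace α]
    {f g : α → Config m × Config m} (hf : Measurable f) (hg : Measurable g) :
    Measurable fun a => commutatorCoeff ħ (f a) (g a) := by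
  have h1 : Measurable fun a => symplectic (f a) (g a) :=
    (hg.fst.inner hf.snd).sub (hf.fst.inner hg.snd)
  have h2 : Measurable fun a => symplectic (g a) (f a) :=
    (hf.fst.inner hg.snd).sub (hg.fst.inner hf.snd)
  unfold commutatorCoeff
  fun_prop

theorem norm_commutatorCoeff_le {ħ : ℝ} (hħ : 0 < ħ) (s s' : Config m × Config m) :
    ‖commutatorCoeff ħ s s'‖ ≤ phaseAbs s * phaseAbs s' := by
  refine le_trans ?_ (abs_symplectic_le s s')
  rw [commutatorCoeff, symplectic_swap s s']
  set ω := symplectic s s'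
  -- Extracting a phase reduces the difference to e^{iħω} - 1, of modulus at most ħ|ω|; this ħ
  -- cancels the prefactor 1/ħ.
  have h1 : Complex.exp (Complex.I * (ħ / 2 * ω : ℝ)) -
      Complex.exp (Complex.I * (ħ / 2 * -ω : ℝ)) =
      Complex.exp ((ħ / 2 * -ω : ℝ) * Complex.I) *
        (Complex.exp (Complex.I * (ħ * ω : ℝ)) - 1) := by
    rw [mul_sub, ← Complex.exp_add, mul_one]
    congr 2
    · push_cast; ring
    · ring
  rw [h1, norm_mul, norm_mul, norm_div, Complex.norm_I, Complex.norm_exp_ofReal_mul_I, one_mul,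
    Complex.norm_real, Real.norm_of_nonneg hħ.le]
  have h2 : ‖Complex.exp (Complex.I * (ħ * ω : ℝ)) - 1‖ ≤ ħ * |ω| := by
    refine (Real.norm_exp_I_mul_ofReal_sub_one_le).trans (le_of_eq ?_)
    rw [Real.norm_eq_abs, abs_mul, abs_of_pos hħ]
  calc 1 / ħ * ‖Complex.exp (Complex.I * (ħ * ω : ℝ)) - 1‖ ≤ 1 / ħ * (ħ * |ω|) := by gcongr
    _ = |ω| := by field_simp

theorem IsWeylMixture.commutator (hħ : 0 < ħ) {ρ₁ ρ₂ B₁ B₂ : ℝ} (hρ : 0 ≤ ρ) (hρ₁ : ρ < ρ₁)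
    (hρ₂ : ρ < ρ₂) {b₁ b₂ : L2 m →L[ℂ] L2 m} (h₁ : IsWeylMixture ħ ρ₁ B₁ b₁)
    (h₂ : IsWeylMixture ħ ρ₂ B₂ b₂) :
    IsWeylMixture ħ ρ (B₁ * B₂ / ((ρ₁ - ρ) * (ρ₂ - ρ)))
      ((Complex.I / (ħ : ℂ)) • ⁅b₁, b₂⁆) := by
  obtain ⟨μ₁, hs₁, hi₁, hle₁, hb₁⟩ := h₁
  obtain ⟨μ₂, hs₂, hi₂, hle₂, hb₂⟩ := h₂
  have hz₁ := integrable_snd_of_integrable_exp_mul (hρ.trans hρ₁.le) hi₁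
  have hz₂ := integrable_snd_of_integrable_exp_mul (hρ.trans hρ₂.le) hi₂
  -- Frequencies add, and the coefficients multiply together with that of the commutator. Keeping z
  -- as a coordinate makes the new measure a pushforward of the product measure.
  let F : ((Config m × Config m) × ℂ) × ((Config m × Config m) × ℂ) →
      (Config m × Config m) × ℂ := fun q =>
    (q.1.1 + q.2.1, q.1.2 * q.2.2 * commutatorCoeff ħ q.1.1 q.2.1)
  have hF : Measurable F := by
    have h4 : Measurable fun q : ((Config m × Config m) × ℂ) × ((Config m × Config m) × ℂ) =>
        q.1.1 + q.2.1 := (measurable_fst.comp measurable_fst).add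
          (measurable_fst.comp measurable_snd)
    have h5 : Measurable fun q : ((Config m × Config m) × ℂ) × ((Config m × Config m) × ℂ) =>
        q.1.2 * q.2.2 := (measurable_snd.comp measurable_fst).mul
          (measurable_snd.comp measurable_snd)
    have h3 : Measurable fun q : ((Config m × Config m) × ℂ) × ((Config m × Config m) × ℂ) =>
        commutatorCoeff ħ q.1.1 q.2.1 :=
      measurable_commutatorCoeff ħ (measurable_fst.comp measurable_fst)
        (measurable_fst.comp measurable_snd)
    exact h4.prodMk (h5.mul h3)
  have hg : Continuous fun q : (Config m × Config m) × ℂ =>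
      Real.exp (ρ * phaseAbs q.1) * ‖q.2‖ := by
    have := continuous_phaseAbs (m := m)
    fun_prop
  have hd : 0 < (ρ₁ - ρ) * (ρ₂ - ρ) := mul_pos (sub_pos.2 hρ₁) (sub_pos.2 hρ₂)
  have hdom := (hi₁.mul_prod hi₂).div_const ((ρ₁ - ρ) * (ρ₂ - ρ))
  have hle : ∀ q : ((Config m × Config m) × ℂ) × ((Config m × Config m) × ℂ),
      Real.exp (ρ * phaseAbs (F q).1) * ‖(F q).2‖ ≤
      Real.exp (ρ₁ * phaseAbs q.1.1) * ‖q.1.2‖ * (Real.exp (ρ₂ * phaseAbs q.2.1) * ‖q.2.2‖) /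
        ((ρ₁ - ρ) * (ρ₂ - ρ)) := by
    intro q
    simp only [F, norm_mul]
    have e1 := mul_exp_le_exp_div (x := phaseAbs q.1.1) hρ₁
    have e2 := mul_exp_le_exp_div (x := phaseAbs q.2.1) hρ₂
    have e3 := norm_commutatorCoeff_le hħ q.1.1 q.2.1
    have n1 := phaseAbs_nonneg q.1.1
    have n2 := phaseAbs_nonneg q.2.1
    calc Real.exp (ρ * phaseAbs (q.1.1 + q.2.1)) *
          (‖q.1.2‖ * ‖q.2.2‖ * ‖commutatorCoeff ħ q.1.1 q.2.1‖)
        ≤ Real.exp (ρ * (phaseAbs q.1.1 + phaseAbs q.2.1)) *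
          (‖q.1.2‖ * ‖q.2.2‖ * (phaseAbs q.1.1 * phaseAbs q.2.1)) := by
          have := phaseAbs_add_le q.1.1 q.2.1
          gcongr
      _ = ‖q.1.2‖ * ‖q.2.2‖ * ((phaseAbs q.1.1 * Real.exp (ρ * phaseAbs q.1.1)) *
          (phaseAbs q.2.1 * Real.exp (ρ * phaseAbs q.2.1))) := by
          rw [mul_add, Real.exp_add]; ring
      _ ≤ ‖q.1.2‖ * ‖q.2.2‖ * ((Real.exp (ρ₁ * phaseAbs q.1.1) / (ρ₁ - ρ)) *
          (Real.exp (ρ₂ * phaseAbs q.2.1) / (ρ₂ - ρ))) := by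
          gcongr
      _ = _ := by rw [div_mul_div_comm]; ring
  have hiF : Integrable (fun q => Real.exp (ρ * phaseAbs (F q).1) * ‖(F q).2‖)
      (μ₁.prod μ₂) := by
    refine hdom.mono' (hg.measurable.comp hF).aestronglyMeasurable
      (Filter.Eventually.of_forall fun q => ?_)
    rw [Real.norm_of_nonneg (by positivity)]
    exact hle q
  have hi : Integrable (fun q => Real.exp (ρ * phaseAbs q.1) * ‖q.2‖) ((μ₁.prod μ₂).map F) := by
    rw [integrable_map_measure hg.aestronglyMeasurable hF.aemeasurable]
    exact hiF
  refine ⟨_, inferInstance, hi, ?_, fun φ ψ => ?_⟩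
  · rw [integral_map hF.aemeasurable hg.aestronglyMeasurable]
    refine (integral_mono hiF hdom hle).trans ?_
    rw [integral_div, integral_prod_mul (fun q : (Config m × Config m) × ℂ =>
      Real.exp (ρ₁ * phaseAbs q.1) * ‖q.2‖) fun q : (Config m × Config m) × ℂ =>
      Real.exp (ρ₂ * phaseAbs q.1) * ‖q.2‖]
    have n2 : 0 ≤ ∫ q, Real.exp (ρ₂ * phaseAbs q.1) * ‖q.2‖ ∂μ₂ :=
      integral_nonneg fun _ => by positivity
    have n1 : 0 ≤ B₁ := (integral_nonneg fun _ => by positivity).trans hle₁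
    gcongr
  · rw [integral_map hF.aemeasurable (integrable_mul_inner_weylOp
      (integrable_snd_of_integrable_exp_mul hρ hi) _ _).aestronglyMeasurable]
    obtain ⟨hj, hp⟩ := inner_comp_eq_integral hz₁ hz₂ hb₁ hb₂ φ ψ
    obtain ⟨hj', hp'⟩ := inner_comp_eq_integral hz₂ hz₁ hb₂ hb₁ φ ψ
    have hjs := hj'.swap
    -- The product b₂b₁ is brought to the same measure μ₁ × μ₂, so that the two orderings subtract
    -- under one integral.
    rw [← integral_prod_swap] at hp'
    simp only [Function.comp_def] at hjs
    rw [Ring.lie_def, smul_apply, inner_smul_right,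
      sub_apply, mul_apply_eq_comp, mul_apply_eq_comp, inner_sub_right, hp, hp',
      ← integral_sub hj hjs,
      ← integral_const_mul]
    refine integral_congr_ae (Filter.Eventually.of_forall fun q => ?_)
    simp only [F, Prod.fst_swap, Prod.snd_swap, commutatorCoeff]
    rw [add_comm q.2.1 q.1.1]
    ring

end Mixture

/-! ### Fourier inversion almost everywhere -/

section Inversion

open FourierTransform

variable {V : Type*} [NormedAddCommGroup V] [InnerProductSpace ℝ V] [FiniteDimensional ℝ V]
  [MeasurableSpace V] [BorelSpace V]

theorem continuous_fourier_of_integrable {f : V → ℂ} (hf : Integrable f) : Continuous (𝓕 f) :=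
  VectorFourier.fourierIntegral_continuous Real.continuous_fourierChar
    (innerSL ℝ (E := V)).continuous₂ hf

theorem integral_fourier_mul_eq_flip {f g : V → ℂ} (hf : Integrable f) (hg : Integrable g) :
    ∫ ξ, 𝓕 f ξ * g ξ = ∫ x, f x * 𝓕 g x := by
  have h := VectorFourier.integral_fourierIntegral_smul_eq_flip (L := innerₗ V)
    Real.continuous_fourierChar (innerSL ℝ (E := V)).continuous₂ hf hg
  rw [flip_innerₗ] at h
  exact h

theorem integral_fourierInv_mul_eq_flip {f g : V → ℂ} (hf : Integrable f) (hg : Integrable g) :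
    ∫ ξ, 𝓕⁻ f ξ * g ξ = ∫ x, f x * 𝓕⁻ g x := by
  have h := integral_fourier_mul_eq_flip hf.comp_neg hg
  rw [← Real.fourierInv_eq_fourier_comp_neg] at h
  rw [h, ← integral_neg_eq_self]
  simp only [neg_neg, ← Real.fourierInv_eq_fourier_neg]

/-- Continuity of f is not assumed, so inversion holds only almost everywhere. A test function G
equals 𝓕(𝓕⁻G), and moving first 𝓕 and then 𝓕⁻ across the pairing gives ∫ G f = ∫ G 𝓕⁻(𝓕f). -/
theorem ae_eq_fourierInv_fourier {f : V → ℂ} (hf : Integrable f) (hf' : Integrable (𝓕 f)) :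
    ∀ᵐ x, f x = 𝓕⁻ (𝓕 f) x := by
  have hc : Continuous (𝓕⁻ (𝓕 f)) := by
    rw [Real.fourierInv_eq_fourier_comp_neg]
    exact continuous_fourier_of_integrable hf'.comp_neg
  refine ae_eq_of_integral_contDiff_smul_eq hf.locallyIntegrable hc.locallyIntegrable
    fun g hg hgs => ?_
  have hs : HasCompactSupport fun x => (g x : ℂ) := hgs.comp_left Complex.ofReal_zero
  let G : SchwartzMap V ℂ := hs.toSchwartzMap (Complex.ofRealCLM.contDiff.comp hg)
  have hG : ∀ x, (G : V → ℂ) x = g x := fun x => rfl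
  have h1 : 𝓕 (𝓕⁻ G : SchwartzMap V ℂ) = G := FourierTransform.fourier_fourierInv_eq G
  have h2 := integral_fourier_mul_eq_flip (𝓕⁻ G : SchwartzMap V ℂ).integrable hf
  have h3 := integral_fourierInv_mul_eq_flip G.integrable hf'
  rw [← SchwartzMap.fourier_coe, h1] at h2
  rw [← SchwartzMap.fourierInv_coe] at h3
  simp only [Complex.real_smul, ← hG]
  rw [h2, h3]

/-- The Fourier integral with the kernel `exp(-i⟨k, x⟩)`. -/
def angularFourier (f : V → ℂ) (k : V) : ℂ :=
  ∫ x, Complex.exp (-(Complex.I * ⟪k, x⟫_ℝ)) * f x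

theorem angularFourier_eq (f : V → ℂ) (k : V) :
    angularFourier f k = 𝓕 f ((2 * Real.pi)⁻¹ • k) := by
  rw [Real.fourier_eq', angularFourier]
  refine integral_congr_ae (Filter.Eventually.of_forall fun x => ?_)
  simp only [smul_eq_mul, inner_smul_right, real_inner_comm x k]
  congr 2
  have : (Real.pi : ℂ) ≠ 0 := by exact_mod_cast Real.pi_ne_zero
  push_cast
  field_simp

theorem continuous_angularFourier {f : V → ℂ} (hf : Integrable f) :
    Continuous (angularFourier f) := by
  have : angularFourier f = fun k => 𝓕 f ((2 * Real.pi)⁻¹ • k) :=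
    funext fun k => angularFourier_eq f k
  rw [this]
  exact (continuous_fourier_of_integrable hf).comp (by fun_prop)

theorem ae_eq_integral_angularFourier {f : V → ℂ} (hf : Integrable f)
    (hf' : Integrable (angularFourier f)) :
    ∀ᵐ x, f x = ((2 * Real.pi : ℂ) ^ Module.finrank ℝ V)⁻¹ *
      ∫ k, angularFourier f k * Complex.exp (Complex.I * ⟪k, x⟫_ℝ) := by
  have hpi : (2 * Real.pi) ≠ 0 := by positivity
  have h1 : ∀ κ, angularFourier f ((2 * Real.pi) • κ) = 𝓕 f κ := fun κ => by
    rw [angularFourier_eq, inv_smul_smul₀ hpi]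
  have h2 : Integrable (𝓕 f) := by
    have := hf'.comp_smul hpi
    simpa only [h1] using this
  filter_upwards [ae_eq_fourierInv_fourier hf h2] with x hx
  rw [hx, Real.fourierInv_eq']
  -- The substitution k = 2πκ between the two normalizations gives the power of 2π.
  have h3 := Measure.integral_comp_smul (volume : Measure V) (fun k =>
    angularFourier f k * Complex.exp (Complex.I * ⟪k, x⟫_ℝ)) (2 * Real.pi)
  rw [abs_of_nonneg (by positivity), Complex.real_smul] at h3
  push_cast at h3
  rw [← h3]
  refine integral_congr_ae (Filter.Eventually.of_forall fun κ => ?_)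
  simp only [h1, smul_eq_mul, inner_smul_left]
  rw [mul_comm]
  congr 2
  simp
  ring

end Inversion

/-! ### Translations, phases and the Fourier transform on `L²` -/

section FourierL2

open FourierTransform

variable {m : ℕ}

/-- `x ↦ exp(i⟨v, x⟩)`. -/
def planeWave (v x : Config m) : ℂ := Complex.exp (Complex.I * (⟪v, x⟫_ℝ : ℝ))

theorem norm_planeWave (v x : Config m) : ‖planeWave v x‖ = 1 := by
  rw [planeWave, mul_comm]
  exact Complex.norm_exp_ofReal_mul_I _

theorem continuous_planeWave (v : Config m) : Continuous (planeWave v) := by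
  unfold planeWave
  fun_prop

theorem memLp_planeWave (v : Config m) : MemLp (planeWave v) ∞ volume :=
  memLp_top_of_continuous_of_norm_le_one (continuous_planeWave v)
    fun x => (norm_planeWave v x).le

/-- The maps need only be continuous, so this applies to operators and also to the antilinear φ ↦
⟪φ, u⟫. -/
theorem ext_schwartz {Y : Type*} [TopologicalSpace Y] [T2Space Y] {A B : L2 m → Y}
    (hA : Continuous A) (hB : Continuous B)
    (H : ∀ ψ : SchwartzMap (Config m) ℂ, A (ψ.toLp 2) = B (ψ.toLp 2)) (ψ : L2 m) :
    A ψ = B ψ := by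
  have h := (SchwartzMap.denseRange_toLpCLM (F := ℂ) (μ := (volume : Measure (Config m)))
    (p := 2) ENNReal.ofNat_ne_top).equalizer hA hB (funext H)
  exact congrFun h ψ

/-- Translation of Schwartz functions. -/
def translateSchwartz (v : Config m) (ψ : SchwartzMap (Config m) ℂ) : SchwartzMap (Config m) ℂ :=
  SchwartzMap.compCLMOfAntilipschitz (𝕜 := ℝ) (K := 1) (g := fun x : Config m => x + v)
    (by fun_prop) ((isometry_add_right v).antilipschitz) ψ

theorem coe_translateSchwartz (v : Config m) (ψ : SchwartzMap (Config m) ℂ) :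
    (translateSchwartz v ψ : Config m → ℂ) = ψ ∘ fun x => x + v := rfl

theorem translationOp_toLp (v : Config m) (ψ : SchwartzMap (Config m) ℂ) :
    translationOp v (ψ.toLp 2) = (translateSchwartz v ψ).toLp 2 := by
  apply Lp.ext
  filter_upwards [coeFn_translationOp v (ψ.toLp 2), (translateSchwartz v ψ).coeFn_toLp 2,
    (measurePreserving_add_right volume v).quasiMeasurePreserving.ae (ψ.coeFn_toLp 2 volume)]
    with x h1 h2 h3
  rw [h1, h2, h3, coe_translateSchwartz]
  rfl

theorem fourier_translationOp (v : Config m) (ψ : L2 m) :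
    𝓕 (translationOp v ψ) = mulOp (planeWave ((2 * Real.pi) • v)) (𝓕 ψ) := by
  refine ext_schwartz (A := fun ψ => 𝓕 (translationOp v ψ))
    (B := fun ψ => mulOp (planeWave ((2 * Real.pi) • v)) (𝓕 ψ))
    (continuous_fourier.comp (translationOp v).continuous)
    ((mulOp _).continuous.comp continuous_fourier) (fun ψ => ?_) ψ
  simp only
  rw [translationOp_toLp, SchwartzMap.toLp_fourier_eq, SchwartzMap.toLp_fourier_eq]
  apply Lp.ext
  filter_upwards [(𝓕 (translateSchwartz v ψ)).coeFn_toLp 2, (𝓕 ψ).coeFn_toLp 2,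
    coeFn_mulOp (memLp_planeWave ((2 * Real.pi) • v)) ((𝓕 ψ).toLp 2)] with κ h1 h2 h3
  rw [h1, h3, h2, SchwartzMap.fourier_coe, SchwartzMap.fourier_coe, coe_translateSchwartz]
  have h4 := congrFun (VectorFourier.fourierIntegral_comp_add_right Real.fourierChar volume
    (innerₗ (Config m)) ψ v) κ
  refine h4.trans ?_
  rw [Circle.smul_def, Real.fourierChar_apply, smul_eq_mul]
  congr 1
  simp only [planeWave, inner_smul_left, innerₗ_apply_apply]
  rw [mul_comm]
  simp

theorem fourierInv_translationOp (v : Config m) (ψ : L2 m) :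
    𝓕⁻ (translationOp v ψ) = mulOp (planeWave (-(2 * Real.pi) • v)) (𝓕⁻ ψ) := by
  refine ext_schwartz (A := fun ψ => 𝓕⁻ (translationOp v ψ))
    (B := fun ψ => mulOp (planeWave (-(2 * Real.pi) • v)) (𝓕⁻ ψ))
    (continuous_fourierInv.comp (translationOp v).continuous)
    ((mulOp _).continuous.comp continuous_fourierInv) (fun ψ => ?_) ψ
  simp only
  rw [translationOp_toLp, SchwartzMap.toLp_fourierInv_eq, SchwartzMap.toLp_fourierInv_eq]
  apply Lp.ext
  filter_upwards [(𝓕⁻ (translateSchwartz v ψ)).coeFn_toLp 2, (𝓕⁻ ψ).coeFn_toLp 2,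
    coeFn_mulOp (memLp_planeWave (-(2 * Real.pi) • v)) ((𝓕⁻ ψ).toLp 2)] with κ h1 h2 h3
  rw [h1, h3, h2, SchwartzMap.fourierInv_coe, SchwartzMap.fourierInv_coe, coe_translateSchwartz]
  have h4 := congrFun (VectorFourier.fourierIntegral_comp_add_right Real.fourierChar volume
    (-innerₗ (Config m)) ψ v) κ
  refine h4.trans ?_
  rw [Circle.smul_def, Real.fourierChar_apply, smul_eq_mul]
  congr 1
  simp only [planeWave, inner_smul_left, LinearMap.neg_apply, innerₗ_apply_apply]
  rw [mul_comm]
  simp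

/-- A plane wave is a momentum shift. In this form its conjugation by the free evolution, a
multiplier in κ, is a pointwise computation. -/
theorem mulOp_planeWave (v : Config m) (ψ : L2 m) :
    mulOp (planeWave v) ψ = 𝓕⁻ (translationOp (-(2 * Real.pi)⁻¹ • v) (𝓕 ψ)) := by
  have hpi : (2 * Real.pi) ≠ 0 := by positivity
  rw [fourierInv_translationOp, FourierTransform.fourierInv_fourier_eq, smul_smul, neg_mul_neg,
    mul_inv_cancel₀ hpi, one_smul]

/-- The multiplier of `freeProp`. -/
def freePhase (ħ : ℝ) (i j : Fin m) (t : ℝ) (κ : Config m) : ℂ :=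
  Complex.exp (-(Complex.I * ((2 * Real.pi) ^ 2 * (‖κ i‖ ^ 2 + ‖κ j‖ ^ 2) * t * ħ / 2 : ℝ)))

theorem norm_freePhase (ħ : ℝ) (i j : Fin m) (t : ℝ) (κ : Config m) :
    ‖freePhase ħ i j t κ‖ = 1 := by
  rw [freePhase, ← mul_neg, ← Complex.ofReal_neg, mul_comm]
  exact Complex.norm_exp_ofReal_mul_I _

theorem memLp_freePhase (ħ : ℝ) (i j : Fin m) (t : ℝ) :
    MemLp (freePhase ħ i j t) ∞ volume := by
  refine memLp_top_of_continuous_of_norm_le_one ?_ fun κ => (norm_freePhase ħ i j t κ).le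
  unfold freePhase
  fun_prop

theorem freeProp_apply (ħ : ℝ) (i j : Fin m) (t : ℝ) (ψ : L2 m) :
    freeProp ħ i j t ψ = 𝓕⁻ (mulOp (freePhase ħ i j t) (𝓕 ψ)) := rfl

/-- Conjugating a plane wave in `x_i, x_j` with the free evolution gives a Weyl operator. -/
theorem freeProp_planeWave_freeProp (ħ : ℝ) {i j : Fin m} (t : ℝ) {v : Config m}
    (hv : ∀ u : Config m, ⟪u i, v i⟫_ℝ + ⟪u j, v j⟫_ℝ = ⟪u, v⟫_ℝ) (ψ : L2 m) :
    freeProp ħ i j t (mulOp (planeWave v) (freeProp ħ i j (-t) ψ)) =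
      weylOp ħ (v, -t • v) ψ := by
  -- The half phase ħ⟨v, -tv⟩/2 contained in W(v, -tv).
  set c : ℂ := Complex.exp (Complex.I * (-(ħ * t / 2 * ⟪v, v⟫_ℝ) : ℝ)) with hc
  have h1 : ∀ χ : L2 m, mulOp (weylPhase ħ (v, -t • v)) χ = c • mulOp (planeWave v) χ := by
    intro χ
    apply Lp.ext
    filter_upwards [coeFn_mulOp (memLp_weylPhase ħ (v, -t • v)) χ,
      coeFn_mulOp (memLp_planeWave v) χ, Lp.coeFn_smul c (mulOp (planeWave v) χ)]
      with x e1 e2 e3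
    rw [e1, e3, Pi.smul_apply, e2, smul_eq_mul, ← mul_assoc]
    congr 1
    rw [hc, weylPhase, planeWave, ← Complex.exp_add, ← mul_add, ← Complex.ofReal_add]
    congr 3
    simp only [inner_smul_right]
    ring
  have hpi : (Real.pi : ℝ) ≠ 0 := Real.pi_ne_zero
  rw [weylOp, ContinuousLinearMap.comp_apply, h1, mulOp_planeWave, mulOp_planeWave,
    freeProp_apply, FourierTransform.fourier_fourierInv_eq, freeProp_apply,
    FourierTransform.fourier_fourierInv_eq, fourier_translationOp,
    ← FourierTransform.fourierInv_smul,
    ← map_smul]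
  congr 1
  set f := 𝓕 ψ
  set a : Config m := -(2 * Real.pi)⁻¹ • v with ha
  set q : Config m := (2 * Real.pi) • ħ • (v, -t • v).2 with hq
  have hmp := (measurePreserving_add_right (volume : Measure (Config m)) a).quasiMeasurePreserving
  apply Lp.ext
  filter_upwards [coeFn_mulOp (memLp_freePhase ħ i j t)
      (translationOp a (mulOp (freePhase ħ i j (-t)) f)),
    coeFn_translationOp a (mulOp (freePhase ħ i j (-t)) f),
    hmp.ae (coeFn_mulOp (memLp_freePhase ħ i j (-t)) f),
    coeFn_translationOp a (c • mulOp (planeWave q) f),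
    hmp.ae (Lp.coeFn_smul c (mulOp (planeWave q) f)),
    hmp.ae (coeFn_mulOp (memLp_planeWave q) f)] with κ e1 e2 e3 e4 e5 e6
  rw [e1, e2, e3, e4, e5, Pi.smul_apply, e6, smul_eq_mul, ← mul_assoc, ← mul_assoc]
  congr 1
  rw [freePhase, freePhase, planeWave, hc, ← Complex.exp_add, ← Complex.exp_add, ← neg_add,
    ← mul_add, ← mul_add, ← Complex.ofReal_add, ← Complex.ofReal_add, ← mul_neg,
    ← Complex.ofReal_neg]
  congr 3
  -- With a = -v/(2π), the terms quadratic in κ cancel between times t and -t. The linear rest is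
  -- the position shift by -ħtv and the constant rest is absorbed by c. By `hv` the components i and
  -- j account for all of v.
  have e7 : ∀ l, ‖(κ + a) l‖ ^ 2 = ‖κ l‖ ^ 2 - Real.pi⁻¹ * ⟪κ l, v l⟫_ℝ +
      ((2 * Real.pi)⁻¹) ^ 2 * ⟪v l, v l⟫_ℝ := fun l => by
    rw [PiLp.add_apply, norm_add_sq_real, ha, PiLp.smul_apply, inner_smul_right, norm_smul, mul_pow,
      real_inner_self_eq_norm_sq, Real.norm_eq_abs, sq_abs, mul_inv]
    ring
  have e8 : ⟪q, κ + a⟫_ℝ = -(2 * Real.pi * ħ * t) * (⟪κ, v⟫_ℝ - (2 * Real.pi)⁻¹ * ⟪v, v⟫_ℝ) := by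
    rw [hq, ha]
    simp only [inner_smul_left, inner_smul_right, inner_add_right, real_inner_comm κ v]
    simp
    ring
  rw [e7, e7, e8, ← hv κ, ← hv v]
  field_simp
  ring

end FourierL2

/-! ### The pair potential as an integral of Weyl operators -/

section PairPotential

variable {m : ℕ}

/-- The frequency of `x ↦ exp(i⟨k, x_i - x_j⟩)`. -/
def pairVec (i j : Fin m) (k : R3) : Config m :=
  WithLp.toLp 2 (Pi.single i k - Pi.single j k)

theorem inner_pairVec (i j : Fin m) (k : R3) (x : Config m) :
    ⟪pairVec i j k, x⟫_ℝ = ⟪k, x i - x j⟫_ℝ := by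
  classical
  have h : ∀ l : Fin m, ∑ q, ⟪(Pi.single l k : Fin m → R3) q, x q⟫_ℝ = ⟪k, x l⟫_ℝ := by
    intro l
    rw [Finset.sum_eq_single l]
    · simp
    · intro q _ hq
      simp [Pi.single_eq_of_ne hq]
    · simp
  rw [PiLp.inner_apply, inner_sub_right, ← h i, ← h j, ← Finset.sum_sub_distrib]
  refine Finset.sum_congr rfl fun q _ => ?_
  rw [← inner_sub_left]
  rfl

theorem pairVec_left {i j : Fin m} (h : i ≠ j) (k : R3) : pairVec i j k i = k := by
  change (Pi.single i k : Fin m → R3) i - (Pi.single j k : Fin m → R3) i = k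
  rw [Pi.single_eq_same, Pi.single_eq_of_ne h, sub_zero]

theorem pairVec_right {i j : Fin m} (h : i ≠ j) (k : R3) : pairVec i j k j = -k := by
  change (Pi.single i k : Fin m → R3) j - (Pi.single j k : Fin m → R3) j = -k
  rw [Pi.single_eq_same, Pi.single_eq_of_ne h.symm, zero_sub]

theorem sum_norm_pairVec_le (i j : Fin m) (k : R3) : ∑ l, ‖pairVec i j k l‖ ≤ 2 * ‖k‖ := by
  classical
  have h : ∀ l : Fin m, ∑ q, ‖(Pi.single l k : Fin m → R3) q‖ = ‖k‖ := by
    intro l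
    rw [Finset.sum_eq_single l]
    · simp
    · intro q _ hq
      simp [Pi.single_eq_of_ne hq]
    · simp
  rw [two_mul]
  nth_rewrite 1 [← h i]
  rw [← h j, ← Finset.sum_add_distrib]
  exact Finset.sum_le_sum fun q _ => norm_sub_le _ _

theorem continuous_pairVec (i j : Fin m) : Continuous (pairVec i j) := by
  unfold pairVec
  refine (PiLp.continuous_toLp 2 _).comp ?_
  have h : ∀ l : Fin m, Continuous fun k : R3 => (Pi.single l k : Fin m → R3) :=
    fun l => continuous_single (A := fun _ : Fin m => R3) l
  exact (h i).sub (h j)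

theorem potFourier_eq (w : R3 → ℝ) (k : R3) :
    potFourier w k = ((2 * Real.pi : ℂ) ^ 3)⁻¹ * angularFourier (fun x => (w x : ℂ)) k := rfl

variable {σ : ℝ} {w : R3 → ℝ}

theorem MemPot.continuous_potFourier (hw : MemPot σ w) : Continuous (potFourier w) := by
  have : potFourier w = fun k => ((2 * Real.pi : ℂ) ^ 3)⁻¹ *
      angularFourier (fun x => (w x : ℂ)) k := funext (potFourier_eq w)
  rw [this]
  exact continuous_const.mul (continuous_angularFourier hw.1.ofReal)

theorem MemPot.integrable_exp_mul (hw : MemPot σ w) :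
    Integrable fun k : R3 => Real.exp (σ * ‖k‖) * ‖potFourier w k‖ := by
  refine hw.2.norm.congr (Filter.Eventually.of_forall fun k => ?_)
  simp only [norm_mul, Complex.norm_real, Real.norm_eq_abs, Real.abs_exp]

theorem MemPot.integrable_potFourier (hσ : 0 ≤ σ) (hw : MemPot σ w) :
    Integrable (potFourier w) := by
  refine hw.integrable_exp_mul.mono' hw.continuous_potFourier.aestronglyMeasurable
    (Filter.Eventually.of_forall fun k => ?_)
  exact le_mul_of_one_le_left (norm_nonneg _)
    (Real.one_le_exp (mul_nonneg hσ (norm_nonneg _)))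

theorem MemPot.ae_eq_integral (hσ : 0 ≤ σ) (hw : MemPot σ w) :
    ∀ᵐ x, (w x : ℂ) = ∫ k, potFourier w k * Complex.exp (Complex.I * ⟪k, x⟫_ℝ) := by
  have h2 : Integrable (angularFourier fun x : R3 => (w x : ℂ)) := by
    refine ((hw.integrable_potFourier hσ).const_mul ((2 * Real.pi : ℂ) ^ 3)).congr
      (Filter.Eventually.of_forall fun k => ?_)
    have : (2 * Real.pi : ℂ) ^ 3 ≠ 0 :=
      pow_ne_zero _ (mul_ne_zero two_ne_zero (Complex.ofReal_ne_zero.2 Real.pi_ne_zero))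
    simp only [potFourier_eq]
    rw [mul_inv_cancel_left₀ this]
  have h1 : Integrable fun x : R3 => (w x : ℂ) := hw.1.ofReal
  filter_upwards [ae_eq_integral_angularFourier h1 h2] with x hx
  refine hx.trans ?_
  rw [← integral_const_mul]
  simp only [finrank_euclideanSpace, Fintype.card_fin, potFourier_eq, mul_assoc]

/-- Inversion for w holds off a null set of ℝ³, which must pull back to a null set of
configurations. For i ≠ j the linear map x ↦ x_i - x_j is onto, so it does. -/
theorem quasiMeasurePreserving_sub_apply {i j : Fin m} (h : i ≠ j) :
    Measure.QuasiMeasurePreserving (fun x : Config m => x i - x j) volume volume := by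
  let L : Config m →ₗ[ℝ] R3 :=
    { toFun := fun x => x i - x j
      map_add' := fun x y => by simp only [PiLp.add_apply]; abel
      map_smul' := fun c x => by simp only [PiLp.smul_apply, smul_sub, RingHom.id_apply] }
  have hL : Function.Surjective L := fun k => by
    refine ⟨(2⁻¹ : ℝ) • pairVec i j k, ?_⟩
    change (2⁻¹ : ℝ) • pairVec i j k i - (2⁻¹ : ℝ) • pairVec i j k j = k
    rw [pairVec_left h, pairVec_right h, ← smul_sub, sub_neg_eq_add, ← two_smul ℝ k, smul_smul]
    norm_num
  obtain ⟨c, -, hc⟩ := L.exists_map_addHaar_eq_smul_addHaar volume volume hL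
  refine ⟨by fun_prop, ?_⟩
  change Measure.map L volume ≪ volume
  rw [hc]
  exact Measure.smul_absolutelyContinuous

/-- By inversion |w| ≤ ∫ |ŵ| almost everywhere, so `mulOp` is genuine multiplication here and not
its default value 0. -/
theorem MemPot.memLp_pair (hσ : 0 ≤ σ) (hw : MemPot σ w) {i j : Fin m} (h : i ≠ j) :
    MemLp (fun x : Config m => (w (x i - x j) : ℂ)) ∞ volume := by
  have hq := quasiMeasurePreserving_sub_apply h
  refine memLp_top_of_bound (hw.1.ofReal.aestronglyMeasurable.comp_quasiMeasurePreserving hq)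
    (∫ k, ‖potFourier w k‖) ?_
  filter_upwards [hq.ae (hw.ae_eq_integral hσ)] with x hx
  rw [hx]
  refine (norm_integral_le_integral_norm _).trans (le_of_eq ?_)
  refine integral_congr_ae (Filter.Eventually.of_forall fun k => ?_)
  simp only
  rw [norm_mul, mul_comm Complex.I, Complex.norm_exp_ofReal_mul_I, mul_one]

theorem MemPot.inner_mulOp (hσ : 0 ≤ σ) (hw : MemPot σ w) {i j : Fin m} (h : i ≠ j)
    (φ ψ : L2 m) :
    ⟪φ, mulOp (fun x => (w (x i - x j) : ℂ)) ψ⟫_ℂ =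
      ∫ k, potFourier w k * ⟪φ, mulOp (planeWave (pairVec i j k)) ψ⟫_ℂ := by
  have hq := quasiMeasurePreserving_sub_apply h
  have hF : Integrable (fun q : Config m × R3 => ⟪(φ q.1 : ℂ), ψ q.1⟫_ℂ * potFourier w q.2 *
      planeWave (pairVec i j q.2) q.1) (volume.prod volume) := by
    refine ((L2.integrable_inner φ ψ).mul_prod (hw.integrable_potFourier hσ)).mul_bdd (c := 1)
      (Continuous.aestronglyMeasurable ?_) (Filter.Eventually.of_forall fun q => ?_)
    · have := continuous_pairVec i j
      unfold planeWave
      fun_prop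
    · rw [norm_planeWave]
  rw [L2.inner_def]
  calc ∫ x, ⟪(φ x : ℂ), mulOp (fun x => (w (x i - x j) : ℂ)) ψ x⟫_ℂ
      = ∫ x, ∫ k, ⟪(φ x : ℂ), ψ x⟫_ℂ * potFourier w k * planeWave (pairVec i j k) x := by
        apply integral_congr_ae
        filter_upwards [coeFn_mulOp (hw.memLp_pair hσ h) ψ, hq.ae (hw.ae_eq_integral hσ)]
          with x h1 h2
        rw [h1, h2, ← smul_eq_mul (∫ k, _), inner_smul_right, mul_comm, ← integral_const_mul]
        simp only [planeWave, inner_pairVec, mul_assoc]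
    _ = ∫ k, ∫ x, ⟪(φ x : ℂ), ψ x⟫_ℂ * potFourier w k * planeWave (pairVec i j k) x :=
        integral_integral_swap hF
    _ = _ := by
        refine integral_congr_ae (Filter.Eventually.of_forall fun k => ?_)
        simp only
        rw [L2.inner_def, ← integral_const_mul]
        apply integral_congr_ae
        filter_upwards [coeFn_mulOp (memLp_planeWave (pairVec i j k)) ψ] with x hx
        rw [hx, ← smul_eq_mul (planeWave _ _), inner_smul_right]
        ring

theorem MemPot.isWeylMixture_pairPotential {ħ T t : ℝ} (hσ : 0 < σ) (hw : MemPot σ w)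
    {i j : Fin m} (h : i ≠ j) (hT : 0 ≤ T) (ht : |t| ≤ T) :
    IsWeylMixture ħ (σ / (2 * (1 + T))) (potNorm σ w) (pairPotential ħ w i j t) := by
  set ρ := σ / (2 * (1 + T)) with hρ
  have hρ0 : 0 ≤ ρ := by positivity
  -- The frequencies fill only a three-dimensional subspace of phase space, which is why mixtures
  -- are described by measures rather than densities.
  let F : R3 → (Config m × Config m) × ℂ := fun k =>
    ((pairVec i j k, -t • pairVec i j k), potFourier w k)
  have hF : Measurable F := by
    have h1 := (continuous_pairVec i j).measurable
    have h2 := hw.continuous_potFourier.measurable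
    exact (h1.prodMk (h1.const_smul (-t))).prodMk h2
  have hg : Continuous fun q : (Config m × Config m) × ℂ =>
      Real.exp (ρ * phaseAbs q.1) * ‖q.2‖ := by
    have := continuous_phaseAbs (m := m)
    fun_prop
  have habs : ∀ k, ρ * phaseAbs (F k).1 ≤ σ * ‖k‖ := fun k => by
    have h1 : phaseAbs (F k).1 ≤ 2 * (1 + T) * ‖k‖ := by
      have e1 : phaseAbs (F k).1 = (1 + |t|) * ∑ l, ‖pairVec i j k l‖ := by
        simp only [F, phaseAbs, PiLp.smul_apply, norm_smul, norm_neg, Real.norm_eq_abs,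
          Finset.sum_add_distrib, ← Finset.mul_sum]
        ring
      calc phaseAbs (F k).1 ≤ (1 + T) * (2 * ‖k‖) := by
            rw [e1]
            have := sum_norm_pairVec_le i j k
            gcongr
        _ = _ := by ring
    calc ρ * phaseAbs (F k).1 ≤ ρ * (2 * (1 + T) * ‖k‖) := by gcongr
      _ = σ * ‖k‖ := by rw [hρ]; field_simp
  have hle : ∀ k, Real.exp (ρ * phaseAbs (F k).1) * ‖(F k).2‖ ≤
      Real.exp (σ * ‖k‖) * ‖potFourier w k‖ := fun k => by
    have := habs k
    gcongr
  have hiF : Integrable fun k => Real.exp (ρ * phaseAbs (F k).1) * ‖(F k).2‖ := by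
    refine hw.integrable_exp_mul.mono' (hg.measurable.comp hF).aestronglyMeasurable
      (Filter.Eventually.of_forall fun k => ?_)
    rw [Real.norm_of_nonneg (by positivity)]
    exact hle k
  have hi : Integrable (fun q => Real.exp (ρ * phaseAbs q.1) * ‖q.2‖)
      ((volume : Measure R3).map F) := by
    rw [integrable_map_measure hg.aestronglyMeasurable hF.aemeasurable]
    exact hiF
  refine ⟨_, inferInstance, hi, ?_, fun φ ψ => ?_⟩
  · rw [integral_map hF.aemeasurable hg.aestronglyMeasurable]
    refine (integral_mono hiF hw.integrable_exp_mul hle).trans (le_of_eq ?_)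
    simp only [potNorm, mul_comm]
  · rw [integral_map hF.aemeasurable (integrable_mul_inner_weylOp
      (integrable_snd_of_integrable_exp_mul hρ0 hi) _ _).aestronglyMeasurable]
    rw [pairPotential, ContinuousLinearMap.comp_apply, ContinuousLinearMap.comp_apply,
      ← ContinuousLinearMap.adjoint_inner_left, hw.inner_mulOp hσ.le h]
    refine integral_congr_ae (Filter.Eventually.of_forall fun k => ?_)
    simp only [F]
    rw [ContinuousLinearMap.adjoint_inner_left, freeProp_planeWave_freeProp ħ t fun u => ?_]
    rw [pairVec_left h, pairVec_right h, real_inner_comm (pairVec i j k) u, inner_pairVec,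
      inner_neg_right, inner_sub_right, real_inner_comm k (u i), real_inner_comm k (u j)]
    ring

end PairPotential

/-! ### Weyl quantizations as integrals of Weyl operators -/

section Quantization

variable {p : ℕ}

theorem finrank_config (m : ℕ) : Module.finrank ℝ (Config m) = 3 * m := by
  rw [(WithLp.linearEquiv 2 ℝ (Fin m → R3)).finrank_eq, Module.finrank_pi_fintype]
  simp [mul_comm]

theorem symFourier_congr {τ τ' : Config p × Config p → ℂ} (h : τ =ᵐ[volume] τ') :
    symFourier τ = symFourier τ' := by
  funext s
  unfold symFourier
  congr 1
  apply integral_congr_ae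
  filter_upwards [h] with z hz
  rw [hz]

theorem quasiMeasurePreserving_midpoint (x : Config p) :
    Measure.QuasiMeasurePreserving
      (fun q : Config p × Config p => ((1 / 2 : ℝ) • (x + q.1), q.2)) volume volume := by
  have h1 : Measure.QuasiMeasurePreserving (fun y : Config p => (1 / 2 : ℝ) • (x + y))
      volume volume := by
    refine Measure.QuasiMeasurePreserving.comp (g := fun y : Config p => (1 / 2 : ℝ) • y) ?_
      (measurePreserving_add_left volume x).quasiMeasurePreserving
    refine ⟨by fun_prop, ?_⟩
    rw [Measure.map_addHaar_smul volume (by norm_num : (1 / 2 : ℝ) ≠ 0)]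
    exact Measure.smul_absolutelyContinuous
  exact QuasiMeasurePreserving.prodMap h1 (Measure.QuasiMeasurePreserving.id volume)

/-- For each fixed x the map (y, ξ) ↦ ((x+y)/2, ξ) pulls null sets back to null sets. A Borel
representative of the symbol may therefore be used, as the measurability arguments below require. -/
theorem IsWeylQuantization.congr {ħ : ℝ} {τ τ' : Config p × Config p → ℂ}
    (h : τ =ᵐ[volume] τ') {a : L2 p →L[ℂ] L2 p} (ha : IsWeylQuantization ħ τ a) :
    IsWeylQuantization ħ τ' a := by
  intro ψ
  filter_upwards [ha ψ] with x hx
  rw [hx]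
  congr 1
  apply integral_congr_ae
  filter_upwards [(quasiMeasurePreserving_midpoint x).ae h] with q hq
  rw [hq]

theorem measurable_symFourier {τ : Config p × Config p → ℂ} (hτ : Measurable τ) :
    Measurable (symFourier τ) := by
  refine Measurable.const_mul ?_ _
  apply StronglyMeasurable.measurable
  apply StronglyMeasurable.integral_prod_right
    (f := fun (s z : Config p × Config p) =>
      Complex.exp (-(Complex.I * (⟪s.1, z.1⟫_ℝ + ⟪s.2, z.2⟫_ℝ : ℝ))) * τ z)
  refine Measurable.stronglyMeasurable (Measurable.mul ?_ (hτ.comp measurable_snd))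
  exact Continuous.measurable (by fun_prop)

/-- The partial Fourier transform of a symbol in the momentum variable. -/
def momentumFourier (τ : Config p × Config p → ℂ) (u s : Config p) : ℂ :=
  angularFourier (fun ξ => τ (u, ξ)) s

variable {τ : Config p × Config p → ℂ}

theorem integrable_momentumFourier_integrand (hi : Integrable τ) (s : Config p) :
    Integrable (fun z : Config p × Config p =>
      Complex.exp (-(Complex.I * ⟪s, z.2⟫_ℝ)) * τ z) (volume.prod volume) := by
  refine Integrable.bdd_mul (c := 1) hi (Continuous.aestronglyMeasurable (by fun_prop))
    (Filter.Eventually.of_forall fun z => ?_)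
  rw [← mul_neg, ← Complex.ofReal_neg, mul_comm, Complex.norm_exp_ofReal_mul_I]

theorem integrable_momentumFourier (hi : Integrable τ) (s : Config p) :
    Integrable fun u => momentumFourier τ u s :=
  (integrable_momentumFourier_integrand hi s).integral_prod_left

theorem symFourier_eq_angularFourier (hi : Integrable τ) (s : Config p × Config p) :
    symFourier τ s = ((2 * Real.pi : ℂ) ^ (6 * p))⁻¹ *
      angularFourier (fun u => momentumFourier τ u s.2) s.1 := by
  have h1 : Integrable (fun z : Config p × Config p =>
      Complex.exp (-(Complex.I * (⟪s.1, z.1⟫_ℝ + ⟪s.2, z.2⟫_ℝ : ℝ))) * τ z)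
      (volume.prod volume) := by
    refine Integrable.bdd_mul (c := 1) hi (Continuous.aestronglyMeasurable (by fun_prop))
      (Filter.Eventually.of_forall fun z => ?_)
    rw [← mul_neg, ← Complex.ofReal_neg, mul_comm, Complex.norm_exp_ofReal_mul_I]
  unfold symFourier angularFourier momentumFourier angularFourier
  congr 1
  rw [Measure.volume_eq_prod, integral_prod _ h1]
  refine integral_congr_ae (Filter.Eventually.of_forall fun u => ?_)
  simp only
  rw [← integral_const_mul]
  refine integral_congr_ae (Filter.Eventually.of_forall fun ξ => ?_)
  simp only
  rw [← mul_assoc, ← Complex.exp_add]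
  congr 2
  push_cast
  ring

/-- The partial inverse Fourier transform of `τ̂` in the first variable. -/
def partialFourierInv (τ : Config p × Config p → ℂ) (u s : Config p) : ℂ :=
  ∫ k, symFourier τ (k, s) * Complex.exp (Complex.I * ⟪k, u⟫_ℝ)

/-- For almost every s the slice τ̂(·, s) is integrable and inversion applies in the position
variable alone. It consumes 3p of the 6p powers of 2π. -/
theorem ae_momentumFourier_eq (hi : Integrable τ) (hs : Integrable (symFourier τ)) :
    ∀ᵐ s, ∀ᵐ u, momentumFourier τ u s = (2 * Real.pi : ℂ) ^ (3 * p) * partialFourierInv τ u s := by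
  have hpi : (2 * Real.pi : ℂ) ≠ 0 :=
    mul_ne_zero two_ne_zero (Complex.ofReal_ne_zero.2 Real.pi_ne_zero)
  have hs' : Integrable (symFourier τ) (volume.prod volume) := hs
  filter_upwards [hs'.prod_left_ae] with s h1
  have h2 : Integrable (angularFourier fun u => momentumFourier τ u s) := by
    refine (h1.const_mul ((2 * Real.pi : ℂ) ^ (6 * p))).congr
      (Filter.Eventually.of_forall fun k => ?_)
    simp only [symFourier_eq_angularFourier hi]
    rw [mul_inv_cancel_left₀ (pow_ne_zero _ hpi)]
  filter_upwards [ae_eq_integral_angularFourier (integrable_momentumFourier hi s) h2] with u hu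
  rw [hu, partialFourierInv]
  simp only [symFourier_eq_angularFourier hi, mul_assoc]
  rw [integral_const_mul, finrank_config, ← mul_assoc ((2 * Real.pi : ℂ) ^ (3 * p))]
  congr 1
  have : (2 * Real.pi : ℂ) ^ (6 * p) =
      (2 * Real.pi : ℂ) ^ (3 * p) * (2 * Real.pi : ℂ) ^ (3 * p) := by
    rw [← pow_add]; congr 1; ring
  rw [this, mul_inv, ← mul_assoc, mul_inv_cancel₀ (pow_ne_zero _ hpi), one_mul]

/-- The Weyl integral evaluates at the sheared point x + cs. For fixed s the shear is a translation
in x, which preserves null sets; Fubini for null sets then exchanges the quantifiers. -/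
theorem ae_ae_momentumFourier_shear (hm : Measurable τ) (hi : Integrable τ)
    (hs : Integrable (symFourier τ)) (c : ℝ) :
    ∀ᵐ x, ∀ᵐ s, momentumFourier τ (x + c • s) s =
      (2 * Real.pi : ℂ) ^ (3 * p) * partialFourierInv τ (x + c • s) s := by
  have hF : Measurable fun q : Config p × Config p => momentumFourier τ q.1 q.2 := by
    unfold momentumFourier angularFourier
    apply StronglyMeasurable.measurable
    apply StronglyMeasurable.integral_prod_right
      (f := fun (q : Config p × Config p) (ξ : Config p) =>
        Complex.exp (-(Complex.I * ⟪q.2, ξ⟫_ℝ)) * τ (q.1, ξ))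
    refine Measurable.stronglyMeasurable (Measurable.mul ?_ (hm.comp (by fun_prop)))
    exact Continuous.measurable (by fun_prop)
  have hH : Measurable fun q : Config p × Config p => partialFourierInv τ q.1 q.2 := by
    unfold partialFourierInv
    apply StronglyMeasurable.measurable
    apply StronglyMeasurable.integral_prod_right
      (f := fun (q : Config p × Config p) (k : Config p) =>
        symFourier τ (k, q.2) * Complex.exp (Complex.I * ⟪k, q.1⟫_ℝ))
    refine Measurable.stronglyMeasurable
      (Measurable.mul ((measurable_symFourier hm).comp (by fun_prop)) ?_)
    exact Continuous.measurable (by fun_prop)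
  have hsh : Measurable fun q : Config p × Config p => (q.1 + c • q.2, q.2) := by fun_prop
  have hset : MeasurableSet {q : Config p × Config p | momentumFourier τ (q.1 + c • q.2) q.2 =
      (2 * Real.pi : ℂ) ^ (3 * p) * partialFourierInv τ (q.1 + c • q.2) q.2} :=
    measurableSet_eq_fun (hF.comp hsh) ((hH.comp hsh).const_mul _)
  refine (Measure.ae_ae_comm hset).2 ?_
  filter_upwards [ae_momentumFourier_eq hi hs] with s h
  exact (measurePreserving_add_right volume (c • s)).quasiMeasurePreserving.ae h

/-- The integral defining the Weyl quantization in terms of the partial Fourier transform. -/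
theorem weylIntegral_eq {ħ : ℝ} (hħ : 0 < ħ) (hi : Integrable τ)
    (ψ : SchwartzMap (Config p) ℂ) (x : Config p) :
    ((2 * Real.pi * ħ : ℂ) ^ (3 * p))⁻¹ * ∫ q : Config p × Config p,
        τ ((1 / 2 : ℝ) • (x + q.1), q.2) *
          Complex.exp (Complex.I * (⟪x - q.1, q.2⟫_ℝ / ħ : ℝ)) * ψ q.1 =
      ((2 * Real.pi : ℂ) ^ (3 * p))⁻¹ *
        ∫ s, momentumFourier τ (x + (ħ / 2) • s) s * ψ (x + ħ • s) := by
  have hτ : Integrable (fun q : Config p × Config p => τ ((1 / 2 : ℝ) • (x + q.1), q.2))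
      (volume.prod volume) := by
    have h1 : Integrable (fun q : Config p × Config p => τ ((1 / 2 : ℝ) • q.1, q.2))
        (volume.prod volume) := by
      have hmap : (volume.prod volume : Measure (Config p × Config p)).map
          (fun q => ((1 / 2 : ℝ) • q.1, q.2)) =
          ENNReal.ofReal |((1 / 2 : ℝ) ^ Module.finrank ℝ (Config p))⁻¹| • volume.prod volume := by
        have := Measure.map_prod_map (volume : Measure (Config p)) (volume : Measure (Config p))
          (f := fun y : Config p => (1 / 2 : ℝ) • y) (g := id) (by fun_prop) measurable_id
        rw [Measure.map_id, Measure.map_addHaar_smul volume (by norm_num : (1 / 2 : ℝ) ≠ 0),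
          Measure.prod_smul_left] at this
        exact this.symm
      have h2 : Integrable τ ((volume.prod volume : Measure (Config p × Config p)).map
          (fun q => ((1 / 2 : ℝ) • q.1, q.2))) := by
        rw [hmap]
        exact Integrable.smul_measure hi ENNReal.ofReal_ne_top
      exact h2.comp_measurable (by fun_prop)
    have hmp : MeasurePreserving (fun q : Config p × Config p => (x + q.1, q.2))
        (volume.prod volume) (volume.prod volume) :=
      (measurePreserving_add_left volume x).prod (MeasurePreserving.id volume)
    exact hmp.integrable_comp_of_integrable h1
  have hint : Integrable (fun q : Config p × Config p => τ ((1 / 2 : ℝ) • (x + q.1), q.2) *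
      Complex.exp (Complex.I * (⟪x - q.1, q.2⟫_ℝ / ħ : ℝ)) * ψ q.1) (volume.prod volume) := by
    refine (hτ.mul_bdd (c := 1) (Continuous.aestronglyMeasurable (by fun_prop))
      (Filter.Eventually.of_forall fun q => ?_)).mul_bdd (c := SchwartzMap.seminorm ℝ 0 0 ψ)
      (ψ.continuous.comp continuous_fst).aestronglyMeasurable
      (Filter.Eventually.of_forall fun q => SchwartzMap.norm_le_seminorm ℝ ψ q.1)
    rw [mul_comm, Complex.norm_exp_ofReal_mul_I]
  -- The substitution y = x + ħs: its Jacobian cancels ħ^{-3p}, the midpoint becomes x + ħs/2, and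
  -- the kernel becomes exp(-i⟨s, ξ⟩).
  have h3 := Measure.integral_comp_smul (volume : Measure (Config p)) (fun v =>
    ∫ ξ, τ ((1 / 2 : ℝ) • (x + (x + v)), ξ) *
      Complex.exp (Complex.I * (⟪x - (x + v), ξ⟫_ℝ / ħ : ℝ)) * ψ (x + v)) ħ
  rw [integral_add_left_eq_self (fun y => ∫ ξ, τ ((1 / 2 : ℝ) • (x + y), ξ) *
      Complex.exp (Complex.I * (⟪x - y, ξ⟫_ℝ / ħ : ℝ)) * ψ y) x, finrank_config,
    abs_of_nonneg (by positivity), Complex.real_smul] at h3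
  rw [Measure.volume_eq_prod, integral_prod _ hint, mul_pow, mul_inv, mul_assoc]
  push_cast at h3
  push_cast
  rw [← h3]
  congr 1
  refine integral_congr_ae (Filter.Eventually.of_forall fun s => ?_)
  simp only [momentumFourier, angularFourier]
  rw [integral_mul_const]
  congr 1
  have e1 : (1 / 2 : ℝ) • (x + (x + ħ • s)) = x + (ħ / 2) • s := by module
  refine integral_congr_ae (Filter.Eventually.of_forall fun ξ => ?_)
  simp only
  rw [e1, mul_comm, sub_add_cancel_left, inner_neg_left, real_inner_smul_left]
  congr 2
  have : (ħ : ℂ) ≠ 0 := Complex.ofReal_ne_zero.2 hħ.ne'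
  push_cast
  field_simp

/-- The half phase ħ⟨k, s⟩/2 of the Weyl operator is what moves the evaluation point from x to the
midpoint x + ħs/2. -/
theorem integral_symFourier_weylPhase {ħ : ℝ} (hs : Integrable (symFourier τ))
    (ψ : SchwartzMap (Config p) ℂ) (x : Config p) :
    ∫ s : Config p × Config p, symFourier τ s * (weylPhase ħ s x * ψ (x + ħ • s.2)) =
      ∫ s, partialFourierInv τ (x + (ħ / 2) • s) s * ψ (x + ħ • s) := by
  have hint : Integrable (fun s : Config p × Config p =>
      symFourier τ s * (weylPhase ħ s x * ψ (x + ħ • s.2))) (volume.prod volume) := by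
    refine Integrable.mul_bdd (c := SchwartzMap.seminorm ℝ 0 0 ψ) hs
      (Continuous.aestronglyMeasurable ?_) (Filter.Eventually.of_forall fun s => ?_)
    · have h1 := ψ.continuous
      unfold weylPhase
      fun_prop
    · rw [norm_mul, norm_weylPhase, one_mul]
      exact SchwartzMap.norm_le_seminorm ℝ ψ _
  rw [Measure.volume_eq_prod, integral_prod_symm _ hint]
  refine integral_congr_ae (Filter.Eventually.of_forall fun s => ?_)
  simp only [partialFourierInv]
  rw [← integral_mul_const]
  refine integral_congr_ae (Filter.Eventually.of_forall fun k => ?_)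
  simp only [weylPhase]
  rw [mul_assoc]
  congr 3
  rw [inner_add_right, inner_smul_right]

theorem IsWeylQuantization.apply_toLp {ħ : ℝ} (hħ : 0 < ħ) (hm : Measurable τ) (hi : Integrable τ)
    (hs : Integrable (symFourier τ)) {a : L2 p →L[ℂ] L2 p} (ha : IsWeylQuantization ħ τ a)
    (ψ : SchwartzMap (Config p) ℂ) :
    a (ψ.toLp 2) =ᵐ[volume] fun x => ∫ s : Config p × Config p,
      symFourier τ s * (weylPhase ħ s x * ψ (x + ħ • s.2)) := by
  have hpi : (2 * Real.pi : ℂ) ≠ 0 :=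
    mul_ne_zero two_ne_zero (Complex.ofReal_ne_zero.2 Real.pi_ne_zero)
  filter_upwards [ha ψ, ae_ae_momentumFourier_shear hm hi hs (ħ / 2)] with x h1 h2
  rw [h1, weylIntegral_eq hħ hi, integral_symFourier_weylPhase hs, ← integral_const_mul]
  apply integral_congr_ae
  filter_upwards [h2] with s h3
  rw [h3, mul_assoc, inv_mul_cancel_left₀ (pow_ne_zero _ hpi)]

theorem IsWeylQuantization.inner_toLp {ħ : ℝ} (hħ : 0 < ħ) (hm : Measurable τ)
    (hi : Integrable τ) (hs : Integrable (symFourier τ)) {a : L2 p →L[ℂ] L2 p}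
    (ha : IsWeylQuantization ħ τ a) (φ ψ : SchwartzMap (Config p) ℂ) :
    ⟪φ.toLp 2, a (ψ.toLp 2)⟫_ℂ =
      ∫ s : Config p × Config p, symFourier τ s * ⟪φ.toLp 2, weylOp ħ s (ψ.toLp 2)⟫_ℂ := by
  have hint : Integrable (fun q : Config p × (Config p × Config p) =>
      (starRingEnd ℂ (φ q.1) * symFourier τ q.2) * (weylPhase ħ q.2 q.1 * ψ (q.1 + ħ • q.2.2)))
      (volume.prod volume) := by
    have hφ : Integrable fun x => starRingEnd ℂ (φ x) :=
      Complex.conjCLE.toContinuousLinearMap.integrable_comp (φ.integrable (μ := volume))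
    refine (hφ.mul_prod hs).mul_bdd (c := SchwartzMap.seminorm ℝ 0 0 ψ)
      (Continuous.aestronglyMeasurable ?_) (Filter.Eventually.of_forall fun s => ?_)
    · have h1 := ψ.continuous
      unfold weylPhase
      fun_prop
    · rw [norm_mul, norm_weylPhase, one_mul]
      exact SchwartzMap.norm_le_seminorm ℝ ψ _
  rw [L2.inner_def]
  calc ∫ x, ⟪(φ.toLp 2 volume x : ℂ), a (ψ.toLp 2 volume) x⟫_ℂ
      = ∫ x, ∫ s : Config p × Config p, (starRingEnd ℂ (φ x) * symFourier τ s) *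
          (weylPhase ħ s x * ψ (x + ħ • s.2)) := by
        apply integral_congr_ae
        filter_upwards [φ.coeFn_toLp 2 volume, ha.apply_toLp hħ hm hi hs ψ] with x h1 h2
        rw [h1, h2, RCLike.inner_apply, mul_comm, ← integral_const_mul]
        simp only [mul_assoc]
    _ = ∫ s : Config p × Config p, ∫ x, (starRingEnd ℂ (φ x) * symFourier τ s) *
          (weylPhase ħ s x * ψ (x + ħ • s.2)) := integral_integral_swap hint
    _ = _ := by
        refine integral_congr_ae (Filter.Eventually.of_forall fun s => ?_)
        simp only
        rw [L2.inner_def, ← integral_const_mul]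
        apply integral_congr_ae
        filter_upwards [φ.coeFn_toLp 2 volume, coeFn_weylOp ħ s (ψ.toLp 2),
          (measurePreserving_add_right volume (ħ • s.2)).quasiMeasurePreserving.ae
            (ψ.coeFn_toLp 2 volume)] with x h1 h2 h3
        rw [h1, h2, h3, RCLike.inner_apply]
        ring

theorem isWeylMixture_of_isWeylQuantization {ħ σ : ℝ} (hħ : 0 < ħ) (hσ : 0 ≤ σ)
    (hτ : MemSym σ τ) {a : L2 p →L[ℂ] L2 p} (ha : IsWeylQuantization ħ τ a) :
    IsWeylMixture ħ σ (symNorm σ τ) a := by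
  obtain ⟨hi, he⟩ := hτ
  set τ' := hi.aestronglyMeasurable.mk τ
  have hττ' : τ =ᵐ[volume] τ' := hi.aestronglyMeasurable.ae_eq_mk
  have hm : Measurable τ' := hi.aestronglyMeasurable.stronglyMeasurable_mk.measurable
  have hi' : Integrable τ' := hi.congr hττ'
  have ha' := ha.congr hττ'
  have hsm := measurable_symFourier hm
  rw [symFourier_congr hττ'] at he
  rw [symNorm, symFourier_congr hττ']
  have hn : Integrable fun s : Config p × Config p =>
      Real.exp (σ * phaseAbs s) * ‖symFourier τ' s‖ := by
    refine he.norm.congr (Filter.Eventually.of_forall fun k => ?_)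
    simp only [norm_mul, Complex.norm_real, Real.norm_eq_abs, Real.abs_exp]
  have hF : Measurable fun s : Config p × Config p => (s, symFourier τ' s) :=
    measurable_id.prodMk hsm
  have hg : Continuous fun q : (Config p × Config p) × ℂ =>
      Real.exp (σ * phaseAbs q.1) * ‖q.2‖ := by
    have := continuous_phaseAbs (m := p)
    fun_prop
  have hw : Integrable (fun q => Real.exp (σ * phaseAbs q.1) * ‖q.2‖)
      ((volume : Measure (Config p × Config p)).map fun s => (s, symFourier τ' s)) := by
    rw [integrable_map_measure hg.aestronglyMeasurable hF.aemeasurable]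
    exact hn
  have hz := integrable_snd_of_integrable_exp_mul hσ hw
  have hs : Integrable (symFourier τ') := hz.comp_measurable hF
  refine ⟨_, inferInstance, hw, ?_, ?_⟩
  · rw [integral_map hF.aemeasurable hg.aestronglyMeasurable]
    simp only [mul_comm, le_refl]
  obtain ⟨b, hb⟩ := exists_integral_weylOp ħ hz
  -- The definition of a Weyl quantization concerns Schwartz functions only; boundedness and density
  -- identify `a` with the operator defined by the measure.
  suffices a = b by rw [this]; exact hb
  refine DFunLike.coe_injective (funext (ext_schwartz a.continuous b.continuous fun ψ => ?_))
  refine ext_inner_left ℂ (ext_schwartz (by fun_prop) (by fun_prop) fun φ => ?_)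
  rw [ha'.inner_toLp hħ hm hi' hs, hb, integral_map hF.aemeasurable
    (integrable_mul_inner_weylOp hz _ _).aestronglyMeasurable]

end Quantization

/-! ### Bounds on the tree amplitudes -/

theorem norm_ampliation_le {k N : ℕ} (h : k ≤ N) (b : L2 k →L[ℂ] L2 k) :
    ‖ampliation h b‖ ≤ ‖b‖ := by
  refine ContinuousLinearMap.opNorm_le_bound _ (norm_nonneg _) fun ψ => ?_
  refine (denseRange_tensorMap h).induction_on
    (p := fun ψ => ‖ampliation h b ψ‖ ≤ ‖b‖ * ‖ψ‖) ψ
    (isClosed_le (by fun_prop) (by fun_prop)) fun u => ?_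
  have h1 : ampliation h b (tensorMap h u) =
      (tensorMap h ∘ₗ (TensorProduct.map b.toLinearMap LinearMap.id)) u :=
    LinearMap.extendOfNorm_eq (denseRange_tensorMap h) ⟨‖b‖, ampliation_tensorMap_bound h b⟩ u
  rw [h1]
  exact ampliation_tensorMap_bound h b u

theorem norm_manyBody_le {k N : ℕ} (h : k ≤ N) (b : L2 k →L[ℂ] L2 k) :
    ‖manyBody h b‖ ≤ ‖b‖ := by
  have h1 : ‖(N.descFactorial k : ℂ) / (N : ℂ) ^ k‖ ≤ 1 := by
    rw [norm_div, norm_pow, Complex.norm_natCast, Complex.norm_natCast]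
    refine div_le_one_of_le₀ ?_ (by positivity)
    exact_mod_cast Nat.descFactorial_le_pow N k
  refine ContinuousLinearMap.opNorm_le_bound _ (norm_nonneg _) fun ψ => ?_
  have h2 : ‖ampliation h b (ψ : L2 N)‖ ≤ ‖b‖ * ‖ψ‖ :=
    ((ampliation h b).le_opNorm _).trans
      (mul_le_mul_of_nonneg_right (norm_ampliation_le h b) (norm_nonneg _))
  have h3 : ‖(symL2 N).orthogonalProjectionOnto (ampliation h b (ψ : L2 N))‖ ≤ ‖b‖ * ‖ψ‖ :=
    ((symL2 N).norm_orthogonalProjectionOnto_apply_le _).trans h2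
  change ‖((N.descFactorial k : ℂ) / (N : ℂ) ^ k) •
    (symL2 N).orthogonalProjectionOnto (ampliation h b (ψ : L2 N))‖ ≤ ‖b‖ * ‖ψ‖
  rw [norm_smul]
  exact (mul_le_of_le_one_left (norm_nonneg _) h1).trans h3

theorem potNorm_nonneg (σ : ℝ) (w : R3 → ℝ) : 0 ≤ potNorm σ w :=
  integral_nonneg fun _ => by positivity

theorem symNorm_nonneg {p : ℕ} (σ : ℝ) (τ : Config p × Config p → ℂ) : 0 ≤ symNorm σ τ :=
  integral_nonneg fun _ => by positivity

/-- One step of the recursion: the loss of analyticity from `ρ'` to `ρ''`. -/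
theorem IsWeylMixture.treeStep {ħ σ T t : ℝ} (hħ : 0 < ħ) (hσ : 0 < σ) (hT : 0 ≤ T)
    (ht : |t| ≤ T) {w : R3 → ℝ} (hw : MemPot σ w) {m : ℕ} {ρ' ρ'' B : ℝ} (h0 : 0 ≤ ρ'')
    (h1 : ρ'' < ρ') (h2 : ρ'' < σ / (2 * (1 + T))) {g : L2 m →L[ℂ] L2 m}
    (hg : IsWeylMixture ħ ρ' B g) :
    IsWeylMixture ħ ρ''
      (m * (potNorm σ w * B / ((σ / (2 * (1 + T)) - ρ'') * (ρ' - ρ''))))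
      ((Complex.I / (ħ : ℂ)) • ∑ i : Fin m,
        ⁅pairPotential ħ w i.castSucc (Fin.last m) t,
          MeanField.ampliation (Nat.le_succ m) g⁆) := by
  rw [Finset.smul_sum]
  have hs := IsWeylMixture.sum h0 (Finset.univ : Finset (Fin m)) fun i =>
    (hw.isWeylMixture_pairPotential (ħ := ħ) hσ (Fin.castSucc_ne_last i) hT ht).commutator hħ
      h0 h2 h1 (hg.ampliation (h0.trans h1.le) (Nat.le_succ m))
  rwa [Finset.card_univ, Fintype.card_fin] at hs

/-- The factor `(p+n)/((ρ-ρ_{n+1})(ρ_n-ρ_{n+1}))` for `ρ_n = ρ/(2(n+1))`. -/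
theorem step_factor_le {ρ : ℝ} (hρ : 0 < ρ) (p n : ℕ) :
    ((p + n : ℕ) : ℝ) / ((ρ - ρ / (2 * ((n + 1 : ℕ) + 1))) *
      (ρ / (2 * (n + 1)) - ρ / (2 * ((n + 1 : ℕ) + 1)))) ≤
      8 * (p + 1) / ρ ^ 2 * (n + 1) ^ 3 := by
  push_cast
  have hn : (0 : ℝ) ≤ n := n.cast_nonneg
  have hp : (0 : ℝ) ≤ p := p.cast_nonneg
  -- The two gaps are ρ(2n+3)/(2(n+2)) and ρ/(2(n+1)(n+2)).
  have e : (ρ - ρ / (2 * ((n : ℝ) + 1 + 1))) *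
      (ρ / (2 * (n + 1)) - ρ / (2 * ((n : ℝ) + 1 + 1))) =
      ρ ^ 2 * (2 * n + 3) / (4 * (n + 1) * (n + 2) ^ 2) := by
    field_simp
    ring
  rw [e, div_div_eq_mul_div, div_le_iff₀ (by positivity)]
  have e2 : 8 * ((p : ℝ) + 1) / ρ ^ 2 * (n + 1) ^ 3 * (ρ ^ 2 * (2 * n + 3)) =
      8 * (p + 1) * (n + 1) ^ 3 * (2 * n + 3) := by
    field_simp
  rw [e2]
  have h1 : (p : ℝ) + n ≤ (p + 1) * (n + 1) := by nlinarith [mul_nonneg hp hn]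
  have h2 : 4 * ((n : ℝ) + 2) ^ 2 ≤ 8 * (n + 1) * (2 * n + 3) := by nlinarith
  calc ((p : ℝ) + n) * (4 * ((n : ℝ) + 1) * ((n : ℝ) + 2) ^ 2)
      = ((p : ℝ) + n) * (n + 1) * (4 * ((n : ℝ) + 2) ^ 2) := by ring
    _ ≤ (((p : ℝ) + 1) * (n + 1)) * (n + 1) * (8 * ((n : ℝ) + 1) * (2 * n + 3)) := by gcongr
    _ = _ := by ring

/-- The widths stay positive for every n, so the recursion never exhausts the analyticity. The cubic
bound `step_factor_le` at each step accumulates to (n!)³. -/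
theorem isWeylMixture_treeAmp {ħ σ T ρ : ℝ} (hħ : 0 < ħ) (hσ : 0 < σ) (hT : 0 ≤ T)
    (hρ : ρ = σ / (2 * (1 + T))) {w : R3 → ℝ} (hw : MemPot σ w) {p : ℕ}
    {τ : Config p × Config p → ℂ} (hτ : MemSym σ τ) {a : L2 p →L[ℂ] L2 p}
    (ha : IsWeylQuantization ħ τ a) {t : ℕ → ℝ} (n : ℕ) (ht : ∀ j, 1 ≤ j → j ≤ n → |t j| ≤ T) :
    IsWeylMixture ħ (ρ / (2 * (n + 1)))
      ((8 * (p + 1) / ρ ^ 2) ^ n * (n.factorial : ℝ) ^ 3 * potNorm σ w ^ n * symNorm σ τ)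
      (treeAmp ħ w a t n) := by
  have hρ0 : 0 < ρ := by rw [hρ]; positivity
  induction n with
  | zero =>
    -- The symbol has width σ ≥ ρ, more than the initial ρ/2.
    refine (isWeylMixture_of_isWeylQuantization hħ hσ.le hτ ha).mono ?_ (by simp)
    have : ρ ≤ σ := by
      rw [hρ]
      exact div_le_self hσ.le (by linarith)
    simp only [Nat.cast_zero, zero_add, mul_one]
    linarith
  | succ n ih =>
    have ih := ih fun j h1 h2 => ht j h1 (h2.trans n.le_succ)
    have hlt : ρ / (2 * ((n + 1 : ℕ) + 1)) < ρ / (2 * (n + 1)) := by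
      push_cast
      gcongr
      linarith
    have hlt' : ρ / (2 * ((n + 1 : ℕ) + 1)) < ρ :=
      div_lt_self hρ0 (by push_cast; linarith [n.cast_nonneg (α := ℝ)])
    have hstep := ih.treeStep hħ hσ hT (ht (n + 1) (by omega) le_rfl) hw (by positivity) hlt
      (hρ ▸ hlt')
    refine hstep.mono le_rfl ?_
    rw [← hρ]
    have hk := step_factor_le hρ0 p n
    have hw0 := potNorm_nonneg σ w
    have hs0 := symNorm_nonneg σ τ
    set K := 8 * ((p : ℝ) + 1) / ρ ^ 2
    have hK : 0 ≤ K := by positivity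
    set D := (ρ - ρ / (2 * (((n + 1 : ℕ) : ℝ) + 1))) *
      (ρ / (2 * ((n : ℝ) + 1)) - ρ / (2 * (((n + 1 : ℕ) : ℝ) + 1)))
    set C := K ^ n * (n.factorial : ℝ) ^ 3 * potNorm σ w ^ n * symNorm σ τ
    have hC : 0 ≤ C := by positivity
    calc ((p + n : ℕ) : ℝ) * (potNorm σ w * C / D)
        = ((p + n : ℕ) : ℝ) / D * (potNorm σ w * C) := by ring
      _ ≤ K * (n + 1) ^ 3 * (potNorm σ w * C) := by gcongr
      _ = _ := by
        rw [Nat.factorial_succ]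
        push_cast
        ring

end MeanField

end

theorem lemma2p3 (p : ℕ) (σ : ℝ) (hσ : 0 < σ) (T : ℝ) :
    ∃ L : ℝ, 0 < L ∧
      ∀ (ħ : ℝ), 0 < ħ →
      ∀ (w : MeanField.R3 → ℝ), MeanField.MemPot σ w →
      ∀ (τ : MeanField.Config p × MeanField.Config p → ℂ), MeanField.MemSym σ τ →
      ∀ (a : MeanField.L2 p →L[ℂ] MeanField.L2 p), MeanField.IsWeylQuantization ħ τ a →
      ∀ (n N : ℕ) (hN : p + n ≤ N) (t : ℕ → ℝ), (∀ j, 1 ≤ j → j ≤ n → |t j| ≤ T) →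
        ‖MeanField.manyBody hN (MeanField.treeAmp ħ w a t n)‖ ≤
          L ^ n * (n.factorial : ℝ) ^ 3 * (2 * MeanField.potNorm σ w) ^ n *
            MeanField.symNorm σ τ := by
  -- This is the constant of `step_factor_le` at width σ/(2(1+|T|)); the absolute value keeps it
  -- positive for every real T.
  refine ⟨8 * (p + 1) / (σ / (2 * (1 + |T|))) ^ 2, by positivity, ?_⟩
  intro ħ hħ w hw τ hτ a ha n N hN t ht
  have h := MeanField.isWeylMixture_treeAmp hħ hσ (abs_nonneg T) rfl hw hτ ha n
    fun j h1 h2 => (ht j h1 h2).trans (le_abs_self T)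
  refine (MeanField.norm_manyBody_le hN _).trans ((h.norm_le (by positivity)).trans ?_)
  have hw0 := MeanField.potNorm_nonneg σ w
  have hs0 := MeanField.symNorm_nonneg σ τ
  gcongr
  -- The factor 2 is pure slack: the sine bound treats both terms of the commutator at once.
  linarith
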